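/- **Setting.** For each $n$ let $x_i=x_{n,i}\in\mathbb{R}^p$ and $d_i=d_{n,i}\in\{0,1\}$ ($1\le i\le n$) be nonrandom, with both treatment values occurring for all large $n$. Let $\|\cdot\|_{\mathcal X}$ be a norm on $\mathbb{R}^p$, $$\mathcal F_{\mathrm{Lip}}(C)=\{f:\ |f(x,d)-f(\tilde x,d)|\le C\|x-\tilde x\|_{\mathcal X}\ \text{for all } x,\tilde x\in\mathbb{R}^p,\ d\in\{0,1\}\},\qquad Lf=\frac1n\sum_{i=1}^n[f(x_i,1)-f(x_i,0)],$$ and let $C_n>0$ be bounded away from $0$ (possibly $C_n\to\infty$). Under $P_f$, $f\in\mathcal F_{\mathrm{Lip}}(C_n)$, we observe $y_i=f(x_i,d_i)+u_i$, where the $u_i$ are independent (not necessarily normal) with $E_fu_i=0$, $E_fu_i^2=\sigma^2(x_i,d_i)$, and, for a constant $K$ not depending on $n,i,f$, $$1/K\le E_fu_i^2\le K,\qquad E_f|u_i|^{2+1/K}\le K;$$ the variance function $\sigma^2(x,d)$ is uniformly continuous in $x$ for $d\in\{0,1\}$. Suppose that $$\text{for all }\eta>0,\quad \min_{1\le i\le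 n}\#\{j:\ \|x_j-x_i\|_{\mathcal X}\le\eta/C_n,\ d_j=d_i\}\to\infty .$$ **Estimator and interval.** Fix $\delta>0$, $\alpha\in(0,1)$ and a nonrandom function $\tilde\sigma^2(x,d)$ bounded away from zero and infinity. Let $\tilde f^*_\delta$ maximize $2Lf$ over $f\in\mathcal F_{\mathrm{Lip}}(C_n)$ subject to $\sum_{i=1}^n f(x_i,d_i)^2/\tilde\sigma^2(x_i,d_i)\le\delta^2/4$, and put $$k_i=\frac{\tilde f^*_\delta(x_i,d_i)/\tilde\sigma^2(x_i,d_i)}{\sum_{j=1}^n d_j\tilde f^*_\delta(x_j,d_j)/\tilde\sigma^2(x_j,d_j)},\qquad \tilde L_\delta=\sum_{i=1}^nk_iy_i,$$ $$B_\delta=\sup_{f\in\mathcal F_{\mathrm{Lip}}(C_n)}\Big[\sum_{i=1}^nk_if(x_i,d_i)-Lf\Big],\qquad \mathrm{se}^2=\sum_{i=1}^nk_i^2\hat u_i^2,\qquad \mathcal C=\big\{\tilde L_\delta\pm \mathrm{cv}_\alpha(B_\delta/\mathrm{se})\,\mathrm{se}\big\},$$ where $\mathrm{cv}_\alpha(b)$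 is the $1-\alpha$ quantile of $|Z|$, $Z\sim N(b,1)$. **Theorem.** We have $$\liminf_{n\to\infty}\ \inf_{f\in\mathcal F_{\mathrm{Lip}}(C_n)}P_f(Lf\in\mathcal C)\ \ge\ 1-\alpha$$ in each of the following two cases. 1. *Nearest-neighbor variance estimates*: $\hat u_i^2=\frac{J}{J+1}\big(y_i-\frac1J\sum_{j\in\mathcal J_i}y_j\big)^2$, where $J\ge1$ is fixed and, for large $n$, $\mathcal J_i$ is a set of $J$ units $j\ne i$ with $d_j=d_i$ that are closest to $i$ in some fixed norm on $\mathbb{R}^p$. Ties may be broken in any nonrandom way such that, for some constant $M$ not depending on $n$ and every $j$, at most $M$ units $i$ with $x_i=x_j$ have $j\in\mathcal J_i$ (this always holds for large $n$ if units with the same treatment have distinct covariates). 2. *Uniform-kernel (Nadaraya–Watson) variance estimates*: $\hat u_i^2=\big(y_i-\frac{1}{\#\mathcal N_i}\sum_{j\in\mathcal N_i}y_j\big)^2$, where $\mathcal N_i=\{j:\|x_j-x_i\|_{\mathcal X}\le h_n,\ d_j=d_i\}$ and $h_nC_n\to0$ slowly enough that $\min_{1\le i\le n}\#\mathcal N_i\to\infty$.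 The requirement on $h_n$ in case 2 is indeed one of slow convergence: there is a positive sequence $\varepsilon_n\to0$ such that $\min_{1\le i\le n}\#\mathcal N_i\to\infty$ for every bandwidth sequence with $h_nC_n\ge\varepsilon_n$ for all large $n$. -/

import Mathlib

open MeasureTheory ProbabilityTheory Filter Topology

noncomputable section

/-- The Lipschitz class: `f (·, d)` is `C`-Lipschitz in the covariates, for both treatment values.
The norm of `E` is the norm on the covariates. -/
def FLip (E : Type*) [NormedAddCommGroup E] (C : ℝ) : Set (E → Bool → ℝ) :=
  {f | ∀ (d : Bool) (x x' : E), |f x d - f x' d| ≤ C * ‖x - x'‖}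

/-- The conditional average treatment effect `Lf`. -/
def cate {E : Type*} {n : ℕ} (x : Fin n → E) (f : E → Bool → ℝ) : ℝ :=
  (1 / (n : ℝ)) * ∑ i, (f (x i) true - f (x i) false)

/-- `P` is a possible law of the outcome vector `y = (y₁, …, yₙ)` in the fixed design model
`y i = f (x i, d i) + u i` under the regression function `f`: the errors `u i` are independent with
mean zero, variance `σ² (x i, d i) ∈ [1/K, K]` and `E |u i| ^ (2 + 1/K) ≤ K`.
The argument `σsq` is the variance function `σ²`. -/
structure FixedDesignModel {E : Type*} {n : ℕ} (K : ℝ) (σsq : E → Bool → ℝ)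
    (x : Fin n → E) (d : Fin n → Bool) (f : E → Bool → ℝ) (P : Measure (Fin n → ℝ)) : Prop where
  isProbabilityMeasure : IsProbabilityMeasure P
  indep : iIndepFun (fun (i : Fin n) (y : Fin n → ℝ) => y i - f (x i) (d i)) P
  integrable : ∀ i, Integrable (fun y : Fin n → ℝ => y i - f (x i) (d i)) P
  mean : ∀ i, ∫ y, (y i - f (x i) (d i)) ∂P = 0
  integrable_sq : ∀ i, Integrable (fun y : Fin n → ℝ => (y i - f (x i) (d i)) ^ 2) P
  variance : ∀ i, ∫ y, (y i - f (x i) (d i)) ^ 2 ∂P = σsq (x i) (d i)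
  variance_lower : ∀ i, 1 / K ≤ ∫ y, (y i - f (x i) (d i)) ^ 2 ∂P
  variance_upper : ∀ i, ∫ y, (y i - f (x i) (d i)) ^ 2 ∂P ≤ K
  integrable_moment :
    ∀ i, Integrable (fun y : Fin n → ℝ => |y i - f (x i) (d i)| ^ (2 + 1 / K)) P
  moment : ∀ i, ∫ y, |y i - f (x i) (d i)| ^ (2 + 1 / K) ∂P ≤ K

/-- `f` solves the problem: maximize `2 Lf` over the Lipschitz class subject to
`∑ f(x i, d i)² / σ̃²(x i, d i) ≤ δ² / 4`. The argument `σtsq` is the variance guess `σ̃²`. -/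
def IsModulusSolution {E : Type*} [NormedAddCommGroup E] {n : ℕ} (C δ : ℝ) (σtsq : E → Bool → ℝ)
    (x : Fin n → E) (d : Fin n → Bool) (f : E → Bool → ℝ) : Prop :=
  let feasible : Set (E → Bool → ℝ) :=
    {g | g ∈ FLip E C ∧ ∑ i, g (x i) (d i) ^ 2 / σtsq (x i) (d i) ≤ δ ^ 2 / 4}
  f ∈ feasible ∧ ∀ g ∈ feasible, 2 * cate x g ≤ 2 * cate x f

/-- The weights of the feasible optimal estimator, computed from a solution `fs` of the
optimization problem. -/
def optimalWeight {E : Type*} {n : ℕ} (σtsq : E → Bool → ℝ) (x : Fin n → E) (d : Fin n → Bool)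
    (fs : E → Bool → ℝ) (i : Fin n) : ℝ :=
  (fs (x i) (d i) / σtsq (x i) (d i)) /
    ∑ j, (if d j = true then fs (x j) (d j) / σtsq (x j) (d j) else 0)

/-- The linear estimator with weights `k`. -/
def linearEstimator {n : ℕ} (k : Fin n → ℝ) (y : Fin n → ℝ) : ℝ := ∑ i, k i * y i

/-- The worst-case bias over the Lipschitz class of the linear estimator with weights `k`. (The
supremum is finite if the weights of the treated units sum to `1` and those of the untreated units
to `-1`, as they do for the optimal weights.) -/
def maxBias {E : Type*} [NormedAddCommGroup E] {n : ℕ} (C : ℝ) (x : Fin n → E) (d : Fin n → Bool)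
    (k : Fin n → ℝ) : ℝ :=
  sSup ((fun f : E → Bool → ℝ => ∑ i, k i * f (x i) (d i) - cate x f) '' FLip E C)

/-- The critical value: the `1 - α` quantile of `|Z|` with `Z ~ N(b, 1)`. -/
def cv (α b : ℝ) : ℝ :=
  sInf {c : ℝ | ENNReal.ofReal (1 - α) ≤ gaussianReal b 1 {z : ℝ | |z| ≤ c}}

/-- The robust standard error with weights `k` and estimates `usq i` of the error variances. -/
def robustSE {n : ℕ} (k usq : Fin n → ℝ) : ℝ := Real.sqrt (∑ i, k i ^ 2 * usq i)

/-- The interval `L̂ ± cv_α(B / se) se`, where `L̂` is the linear estimator with weights `k`,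
`B` is its worst-case bias and `se` its robust standard error. -/
def feasibleFLCI {E : Type*} [NormedAddCommGroup E] {n : ℕ} (α C : ℝ) (x : Fin n → E)
    (d : Fin n → Bool) (k : Fin n → ℝ) (usq : Fin n → ℝ) (y : Fin n → ℝ) : Set ℝ :=
  Set.Icc
    (linearEstimator k y - cv α (maxBias C x d k / robustSE k usq) * robustSE k usq)
    (linearEstimator k y + cv α (maxBias C x d k / robustSE k usq) * robustSE k usq)

open Classical in
/-- The same-treatment units (`i` included) within distance `r` of unit `i`. -/
def armBall {E : Type*} [NormedAddCommGroup E] {n : ℕ} (x : Fin n → E) (d : Fin n → Bool)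
    (r : ℝ) (i : Fin n) : Finset (Fin n) :=
  Finset.univ.filter fun j => ‖x j - x i‖ ≤ r ∧ d j = d i

/-- `min_i #{j : ‖x_j - x_i‖ ≤ r_n, d_j = d_i} → ∞` along a triangular array of designs. -/
def ArmBallsGrow {E : Type*} [NormedAddCommGroup E] (x : (n : ℕ) → Fin n → E)
    (d : (n : ℕ) → Fin n → Bool) (r : ℕ → ℝ) : Prop :=
  ∀ M : ℕ, ∀ᶠ n in atTop, ∀ i : Fin n, M ≤ (armBall (x n) (d n) (r n) i).card

/-- The squared residuals of the Nadaraya-Watson estimator with uniform kernel, bandwidth `h`. -/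
def nwResidualSq {E : Type*} [NormedAddCommGroup E] {n : ℕ} (x : Fin n → E) (d : Fin n → Bool)
    (h : ℝ) (y : Fin n → ℝ) (i : Fin n) : ℝ :=
  (y i - (∑ j ∈ armBall x d h i, y j) / ((armBall x d h i).card : ℝ)) ^ 2

/-- `S` is a set of `J` nearest neighbors of `i` (`i` excluded), with respect to the distance `N`,
among the units with the same treatment as `i`; ties may be broken in any way. -/
def IsNearestNeighbors {E : Type*} [AddCommGroup E] [Module ℝ E] {n : ℕ} (N : Seminorm ℝ E)
    (x : Fin n → E) (d : Fin n → Bool) (J : ℕ) (i : Fin n) (S : Finset (Fin n)) : Prop :=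
  S.card = J ∧ (∀ j ∈ S, j ≠ i ∧ d j = d i) ∧
    ∀ j ∈ S, ∀ l, l ∉ S → l ≠ i → d l = d i → N (x j - x i) ≤ N (x l - x i)

/-- The nearest-neighbor variance estimates, where `nn i` is the set of the `J` neighbors of `i`. -/
def nnResidualSq {n : ℕ} (J : ℕ) (nn : Fin n → Finset (Fin n)) (y : Fin n → ℝ) (i : Fin n) : ℝ :=
  ((J : ℝ) / ((J : ℝ) + 1)) * (y i - (∑ j ∈ nn i, y j) / (J : ℝ)) ^ 2

open Classical in
/-- Ties between exact duplicates are not always broken in favor of the same unit: for some `M`, in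
all samples, each unit `j` is a selected neighbor of at most `M` units `i` with `x i = x j`. This
holds with `M = 0` if the covariates of units with the same treatment are distinct. -/
def DuplicateUseBounded {E : Type*} (x : (n : ℕ) → Fin n → E)
    (nn : (n : ℕ) → Fin n → Finset (Fin n)) : Prop :=
  ∃ M : ℕ, ∀ (n : ℕ) (j : Fin n),
    (Finset.univ.filter fun i : Fin n => x n i = x n j ∧ j ∈ nn n i).card ≤ M

/-- `liminf_n inf_{f ∈ FLip(C_n)} P_f (Lf ∈ 𝒞_n) ≥ 1 - α`, where `P n f` is the law of the outcomes
under `f` and `𝒞 n` is the confidence set as a function of the outcomes. -/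
def HasAsymptoticCoverage {E : Type*} [NormedAddCommGroup E] (α : ℝ) (C : ℕ → ℝ)
    (x : (n : ℕ) → Fin n → E) (P : (n : ℕ) → (E → Bool → ℝ) → Measure (Fin n → ℝ))
    (𝒞 : (n : ℕ) → (Fin n → ℝ) → Set ℝ) : Prop :=
  ENNReal.ofReal (1 - α) ≤
    liminf (fun n => ⨅ f ∈ FLip E (C n), P n f {y | cate (x n) f ∈ 𝒞 n y}) atTop

end

/-!
The estimation error is the sum of a nonrandom bias, bounded by the worst-case bias, and of a
weighted sum of the errors. The interval covers because, uniformly over the Lipschitz class, this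
weighted sum is approximately normal and the robust standard error is close to its standard
deviation.

*Weights.* Shifting the solution of the modulus problem by constants in each treatment arm, and
shrinking it, gives first order conditions (`modulus_first_order`): the constraint binds, and the
weights form a contrast (`IsModulusSolution.isContrast`), so that the worst-case bias is finite. A
value of the solution bounded away from zero at one unit would, by the Lipschitz condition, force
values bounded away from zero at all units nearby. There are arbitrarily many of them, which
contradicts the constraint. Hence no unit has more than a negligible share of the sum of squared
weights (`eventually_optimalWeight_sq_le`).

*Normal approximation.* The moment bound of order `2 + 1/K` enters only through the uniform tail
bound `E[u² ; |u| > T] ≤ K T ^ (-1/K)`. Lindeberg's argument bounds the distance between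
characteristic functions (`CenteredErrors.norm_charFun_sum_sub_le`). Lévy's theorem, together with
the Lévy-Prokhorov metric, turns this into a bound over all intervals
(`eventually_gaussianReal_Icc_le`), which is needed because the bias varies with the sample size and
need not be small relative to the standard error. It is uniform over the Lipschitz class because it
holds along a worst sequence of regression functions.

*Standard errors.* The regression function and the error variances are almost constant among
neighbors and within windows. The nearest-neighbor estimate is then essentially a quadratic form in
the errors, whose coefficients are small if no unit is a neighbor of too many others. This is a
geometric fact about finite-dimensional norms (`exists_card_neighborOf_le`) for units at distinct
locations, and a hypothesis for duplicates. Such forms concentrate around their means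
(`CenteredErrors.integrable_quadForm_and_integral_abs_le`): truncation deals with the diagonal, and
orthogonality with the rest. For kernel estimates, the window averages of the errors are negligible.

*Coverage.* The half-length of the interval is stable under small relative errors of the standard
error, uniformly in the bias (`exists_cv_le_mul_cv`), because `|b + r z|` and `|b + z|` differ by at
most `|r - 1| |z|`. The probability that a normal variable lies in a centered interval decreases
with the absolute value of its mean (`foldedNormalCDF_antitone`), so the worst case is the largest
bias. These facts combine in `hasAsymptoticCoverage_feasibleFLCI`.
-/

/-! ### Folded normal distributions and critical values -/

/-- The distribution function at `c` of `|Z|` with `Z ~ N(b, 1)`. -/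
noncomputable def foldedNormalCDF (b c : ℝ) : ℝ := (gaussianReal b 1).real {z | |z| ≤ c}

theorem foldedNormalCDF_eq_Icc (b c : ℝ) :
    foldedNormalCDF b c = (gaussianReal 0 1).real (Set.Icc (-c - b) (c - b)) := by
  have h := gaussianReal_map_add_const (μ := 0) (v := 1) b
  rw [zero_add] at h
  rw [foldedNormalCDF, ← h, map_measureReal_apply (by fun_prop)
    (measurableSet_le (by fun_prop) (by fun_prop))]
  congr 1
  ext z
  simp only [Set.mem_preimage, Set.mem_ofPred_eq, abs_le, Set.mem_Icc]
  constructor <;> rintro ⟨h1, h2⟩ <;> constructor <;> linarith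

theorem foldedNormalCDF_mono (b : ℝ) : Monotone (foldedNormalCDF b) := fun _ _ h =>
  measureReal_mono fun _ hz => le_trans hz h

theorem foldedNormalCDF_of_neg (b : ℝ) {c : ℝ} (hc : c < 0) : foldedNormalCDF b c = 0 := by
  have : {z : ℝ | |z| ≤ c} = ∅ := by
    ext z
    simpa using hc.trans_le (abs_nonneg z)
  simp [foldedNormalCDF, this]

theorem gaussianPDFReal_zero_one_le_one (x : ℝ) : gaussianPDFReal 0 1 x ≤ 1 := by
  rw [gaussianPDFReal]
  have h1 : (√(2 * Real.pi * ((1 : NNReal) : ℝ)))⁻¹ ≤ 1 := by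
    apply inv_le_one_of_one_le₀
    rw [Real.one_le_sqrt]
    have := Real.pi_gt_three
    simp
    linarith
  have h2 : Real.exp (-(x - 0) ^ 2 / (2 * ((1 : NNReal) : ℝ))) ≤ 1 := by
    rw [Real.exp_le_one_iff]
    have := sq_nonneg x
    simp
    linarith
  exact mul_le_one₀ h1 (Real.exp_nonneg _) h2

theorem gaussianReal_real_Icc {a b : ℝ} (hab : a ≤ b) :
    (gaussianReal 0 1).real (Set.Icc a b) = ∫ x in a..b, gaussianPDFReal 0 1 x := by
  rw [intervalIntegral.integral_of_le hab, ← integral_Icc_eq_integral_Ioc, measureReal_def,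
    gaussianReal_apply_eq_integral _ one_ne_zero, ENNReal.toReal_ofReal]
  exact integral_nonneg fun x => gaussianPDFReal_nonneg _ _ _

theorem gaussianReal_real_Icc_le {a b : ℝ} (hab : a ≤ b) :
    (gaussianReal 0 1).real (Set.Icc a b) ≤ b - a := by
  rw [gaussianReal_real_Icc hab]
  have : ∫ x in a..b, gaussianPDFReal 0 1 x ≤ ∫ x in a..b, (1 : ℝ) :=
    intervalIntegral.integral_mono_on hab (integrable_gaussianPDFReal 0 1).intervalIntegrable
      (by simp) fun x _ => gaussianPDFReal_zero_one_le_one x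
  simpa using this

/-- Lipschitz continuity, uniformly in `b`, since the normal density is at most `1`. -/
theorem foldedNormalCDF_add_le (b c : ℝ) {h : ℝ} (hh : 0 ≤ h) :
    foldedNormalCDF b (c + h) ≤ foldedNormalCDF b c + 2 * h := by
  rw [foldedNormalCDF_eq_Icc, foldedNormalCDF_eq_Icc]
  have hsub : Set.Icc (-(c + h) - b) (c + h - b) ⊆
      Set.Icc (-c - b) (c - b) ∪
        (Set.Icc (-(c + h) - b) (-c - b) ∪ Set.Icc (c - b) (c + h - b)) := by
    intro z hz
    simp only [Set.mem_union, Set.mem_Icc] at *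
    by_cases h1 : z ≤ -c - b
    · exact Or.inr (Or.inl ⟨hz.1, h1⟩)
    · by_cases h2 : z ≤ c - b
      · exact Or.inl ⟨by linarith, h2⟩
      · exact Or.inr (Or.inr ⟨by linarith, hz.2⟩)
  have h1 := measureReal_mono (μ := gaussianReal 0 1) hsub
  have h2 := measureReal_union_le (μ := gaussianReal 0 1) (Set.Icc (-c - b) (c - b))
    (Set.Icc (-(c + h) - b) (-c - b) ∪ Set.Icc (c - b) (c + h - b))
  have h3 := measureReal_union_le (μ := gaussianReal 0 1)
    (Set.Icc (-(c + h) - b) (-c - b)) (Set.Icc (c - b) (c + h - b))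
  have h4 := gaussianReal_real_Icc_le (a := -(c + h) - b) (b := -c - b) (by linarith)
  have h5 := gaussianReal_real_Icc_le (a := c - b) (b := c + h - b) (by linarith)
  linarith

theorem foldedNormalCDF_neg (b c : ℝ) : foldedNormalCDF (-b) c = foldedNormalCDF b c := by
  rw [foldedNormalCDF, ← gaussianReal_map_neg, map_measureReal_apply (by fun_prop)
    (measurableSet_le (by fun_prop) (by fun_prop)), foldedNormalCDF]
  simp

theorem gaussianPDFReal_zero_one_neg (x : ℝ) : gaussianPDFReal 0 1 (-x) = gaussianPDFReal 0 1 x := by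
  simp [gaussianPDFReal]

theorem gaussianPDFReal_zero_one_le_of_abs_le {x y : ℝ} (h : |x| ≤ |y|) :
    gaussianPDFReal 0 1 y ≤ gaussianPDFReal 0 1 x := by
  have := sq_le_sq.2 h
  simp only [gaussianPDFReal, sub_zero]
  gcongr

/-- The probability that a normal variable lies in a centered interval decreases with its mean:
the mass lost at the upper end point exceeds the mass gained at the lower one. -/
theorem foldedNormalCDF_antitone {b β : ℝ} (h : |b| ≤ β) (c : ℝ) :
    foldedNormalCDF β c ≤ foldedNormalCDF b c := by
  wlog hb : 0 ≤ b generalizing b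
  · have := this (b := -b) (by rwa [abs_neg]) (by linarith)
    rwa [foldedNormalCDF_neg] at this
  rw [abs_of_nonneg hb] at h
  rcases lt_or_ge c 0 with hc | hc
  · rw [foldedNormalCDF_of_neg _ hc, foldedNormalCDF_of_neg _ hc]
  have hint : ∀ s t : ℝ, IntervalIntegrable (gaussianPDFReal 0 1) volume s t := fun s t =>
    (integrable_gaussianPDFReal 0 1).intervalIntegrable
  rw [foldedNormalCDF_eq_Icc, foldedNormalCDF_eq_Icc, gaussianReal_real_Icc (by linarith),
    gaussianReal_real_Icc (by linarith)]
  have e1 := intervalIntegral.integral_add_adjacent_intervals (hint (-c - β) (-c - b))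
    (hint (-c - b) (c - β))
  have e2 := intervalIntegral.integral_add_adjacent_intervals (hint (-c - b) (c - β))
    (hint (c - β) (c - b))
  have e3 : ∫ x in (-c - β)..(-c - b), gaussianPDFReal 0 1 x =
      ∫ t in b..β, gaussianPDFReal 0 1 (c + t) := by
    rw [intervalIntegral.integral_comp_add_left, ← neg_add', ← neg_add',
      ← intervalIntegral.integral_comp_neg]
    simp only [gaussianPDFReal_zero_one_neg]
  have e4 : ∫ x in (c - β)..(c - b), gaussianPDFReal 0 1 x =
      ∫ t in b..β, gaussianPDFReal 0 1 (c - t) := by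
    rw [intervalIntegral.integral_comp_sub_left]
  have e5 : ∫ t in b..β, gaussianPDFReal 0 1 (c + t) ≤
      ∫ t in b..β, gaussianPDFReal 0 1 (c - t) := by
    refine intervalIntegral.integral_mono_on h ?_ ?_ fun t ht => ?_
    · exact ((integrable_gaussianPDFReal 0 1).comp_add_left c).intervalIntegrable
    · exact ((integrable_gaussianPDFReal 0 1).comp_sub_left c).intervalIntegrable
    · have h0 : 0 ≤ t := hb.trans ht.1
      refine gaussianPDFReal_zero_one_le_of_abs_le ?_
      rw [abs_of_nonneg (by linarith : 0 ≤ c + t), abs_le]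
      constructor <;> linarith
  linarith

theorem ofReal_le_gaussianReal_iff (q b c : ℝ) :
    ENNReal.ofReal q ≤ gaussianReal b 1 {z : ℝ | |z| ≤ c} ↔ q ≤ foldedNormalCDF b c := by
  rw [foldedNormalCDF, measureReal_def, ENNReal.ofReal_le_iff_le_toReal (measure_ne_top _ _)]

theorem cv_eq_sInf (α b : ℝ) : cv α b = sInf {c : ℝ | 1 - α ≤ foldedNormalCDF b c} := by
  simp only [cv, ofReal_le_gaussianReal_iff]

theorem zero_mem_lowerBounds_quantileSet {α : ℝ} (h1 : α < 1) (b : ℝ) :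
    (0 : ℝ) ∈ lowerBounds {c : ℝ | 1 - α ≤ foldedNormalCDF b c} := by
  intro c hc
  by_contra! hneg
  rw [Set.mem_ofPred_eq, foldedNormalCDF_of_neg b hneg] at hc
  linarith

/-- For `α < 1` the set that defines the critical value is bounded below, so that its infimum is not
a junk value. -/
theorem cv_le {α b c : ℝ} (h1 : α < 1) (h : 1 - α ≤ foldedNormalCDF b c) : cv α b ≤ c := by
  rw [cv_eq_sInf]
  exact csInf_le ⟨0, zero_mem_lowerBounds_quantileSet h1 b⟩ h

theorem tendsto_foldedNormalCDF_atTop (b : ℝ) :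
    Tendsto (fun k : ℕ => foldedNormalCDF b k) atTop (𝓝 1) := by
  have hU : ⋃ k : ℕ, {z : ℝ | |z| ≤ k} = Set.univ := by
    ext z
    simpa using exists_nat_ge |z|
  have h := tendsto_measure_iUnion_atTop (μ := gaussianReal b 1) (s := fun k : ℕ => {z : ℝ | |z| ≤ k})
    (fun k l hkl z hz => le_trans (Set.mem_ofPred_eq ▸ hz) (by exact_mod_cast hkl))
  rw [hU, measure_univ] at h
  exact (ENNReal.tendsto_toReal ENNReal.one_ne_top).comp h

/-- The critical value attains its level, by continuity of the distribution function. -/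
theorem le_foldedNormalCDF_cv {α : ℝ} (h0 : 0 < α) (b : ℝ) :
    1 - α ≤ foldedNormalCDF b (cv α b) := by
  have hne : {c : ℝ | 1 - α ≤ foldedNormalCDF b c}.Nonempty := by
    obtain ⟨k, hk⟩ := ((tendsto_foldedNormalCDF_atTop b).eventually
      (lt_mem_nhds (by linarith : 1 - α < 1))).exists
    exact ⟨k, hk.le⟩
  refine le_of_forall_pos_le_add fun ε hε => ?_
  obtain ⟨c, hc, hlt⟩ := Real.lt_sInf_add_pos hne (half_pos hε)
  rw [← cv_eq_sInf] at hlt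
  calc 1 - α ≤ foldedNormalCDF b c := hc
    _ ≤ foldedNormalCDF b (cv α b + ε / 2) := foldedNormalCDF_mono b hlt.le
    _ ≤ foldedNormalCDF b (cv α b) + 2 * (ε / 2) := foldedNormalCDF_add_le b _ (by linarith)
    _ = _ := by ring

/-- Scaling the noise by `r` changes `|b + z|` by at most `|r - 1| |z|`. -/
theorem foldedNormalCDF_div_le {b c r h η : ℝ} (hr : 0 < r) (hh : 0 < h)
    (hη : |r - 1| ≤ η) :
    foldedNormalCDF (b / r) (c / r) ≤ foldedNormalCDF b (c + h) + (η / h) ^ 2 := by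
  have hη0 : 0 ≤ η := (abs_nonneg _).trans hη
  rw [foldedNormalCDF_eq_Icc, foldedNormalCDF_eq_Icc]
  have hsub : Set.Icc (-(c / r) - b / r) (c / r - b / r) ⊆
      Set.Icc (-(c + h) - b) (c + h - b) ∪ {z | h ≤ η * |z|} := by
    intro z hz
    by_cases hzh : h ≤ η * |z|
    · exact Or.inr hzh
    left
    push Not at hzh
    have h1 : |r * z - z| < h := by
      rw [← sub_one_mul, abs_mul]
      exact (mul_le_mul_of_nonneg_right hη (abs_nonneg _)).trans_lt hzh
    rw [abs_lt] at h1
    obtain ⟨hz1, hz2⟩ := hz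
    have hz1' := mul_le_mul_of_nonneg_left hz1 hr.le
    have hz2' := mul_le_mul_of_nonneg_left hz2 hr.le
    have e1 : r * (-(c / r) - b / r) = -c - b := by field_simp
    have e2 : r * (c / r - b / r) = c - b := by field_simp
    rw [e1] at hz1'
    rw [e2] at hz2'
    constructor <;> linarith
  have htail : (gaussianReal 0 1).real {z : ℝ | h ≤ η * |z|} ≤ (η / h) ^ 2 := by
    have hmem : MemLp (id : ℝ → ℝ) 2 (gaussianReal 0 1) := memLp_id_gaussianReal 2
    have hi : ∫ z, (η * z) ^ 2 ∂gaussianReal 0 1 = η ^ 2 := by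
      have hv := variance_of_integral_eq_zero (μ := gaussianReal 0 1) (X := id)
        aemeasurable_id integral_id_gaussianReal
      rw [variance_id_gaussianReal] at hv
      simp only [mul_pow, integral_const_mul]
      simp only [id_eq] at hv
      simp [← hv]
    have hm := mul_meas_ge_le_integral_of_nonneg (μ := gaussianReal 0 1)
      (f := fun z : ℝ => (η * z) ^ 2) (ae_of_all _ fun z => sq_nonneg _)
      ((hmem.integrable_sq.const_mul (η ^ 2)).congr (ae_of_all _ fun z => by simp [mul_pow])) (h ^ 2)
    rw [hi] at hm
    have hset : {z : ℝ | h ≤ η * |z|} ⊆ {z | h ^ 2 ≤ (η * z) ^ 2} := by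
      intro z hz
      rw [Set.mem_ofPred_eq, ← sq_abs (η * z), abs_mul, abs_of_nonneg hη0]
      exact pow_le_pow_left₀ hh.le hz 2
    have := measureReal_mono (μ := gaussianReal 0 1) hset
    rw [div_pow, le_div_iff₀ (by positivity)]
    nlinarith [sq_nonneg h]
  have h1 := measureReal_mono (μ := gaussianReal 0 1) hsub
  have h2 := measureReal_union_le (μ := gaussianReal 0 1)
    (Set.Icc (-(c + h) - b) (c + h - b)) {z | h ≤ η * |z|}
  linarith

/-- The interval half-length is stable, uniformly in the bias bound `β`, under a small relative
error `r` in the standard error, at the price of a slightly smaller level. -/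
theorem exists_cv_le_mul_cv {α τ : ℝ} (h0 : 0 < α) (hτ : 0 < τ) (h1 : α + τ < 1) :
    ∃ η : ℝ, 0 < η ∧ η < 1 ∧
      ∀ r β : ℝ, |r - 1| ≤ η → cv (α + τ) β ≤ cv α (β / r) * r := by
  refine ⟨min (1 / 2) (τ ^ 2 / 8), by positivity, lt_of_le_of_lt (min_le_left _ _) (by norm_num),
    fun r β hr => cv_le h1 ?_⟩
  set η := min (1 / 2) (τ ^ 2 / 8)
  have hr0 : 0 < r := by
    have := (abs_le.1 (hr.trans (min_le_left _ _))).1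
    linarith
  have hc := le_foldedNormalCDF_cv h0 (β / r)
  have hcr : cv α (β / r) = cv α (β / r) * r / r := by field_simp
  have h2 := foldedNormalCDF_div_le (b := β) (c := cv α (β / r) * r) hr0
    (h := τ / 4) (by linarith) hr
  rw [← hcr] at h2
  have h3 := foldedNormalCDF_add_le β (cv α (β / r) * r) (h := τ / 4) (by linarith)
  have h4 : (η / (τ / 4)) ^ 2 ≤ τ / 2 := by
    have hη0 : 0 < η := by positivity
    have e1 : η / (τ / 4) ≤ τ / 2 := by
      rw [div_le_iff₀ (by linarith)]
      have := min_le_right (1 / 2) (τ ^ 2 / 8)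
      nlinarith
    have e2 : 0 ≤ η / (τ / 4) := by positivity
    nlinarith
  linarith

/-! ### Characteristic functions of weighted sums of independent errors -/

/-- The square of `v` if `|v| > T`, and zero otherwise. -/
noncomputable def tailSq (T v : ℝ) : ℝ := if T < |v| then v ^ 2 else 0

theorem measurable_tailSq (T : ℝ) : Measurable (tailSq T) :=
  Measurable.ite (measurableSet_lt measurable_const (by fun_prop)) (by fun_prop) (by fun_prop)

theorem tailSq_nonneg (T v : ℝ) : 0 ≤ tailSq T v := by
  unfold tailSq; split_ifs <;> positivity

theorem tailSq_le (T v : ℝ) : tailSq T v ≤ v ^ 2 := by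
  unfold tailSq; split_ifs <;> first | rfl | positivity

/-- Independent centered errors with second moments at most `K`, whose squares are uniformly
integrable: `E[u² ; |u| > T] ≤ τ T`. -/
structure CenteredErrors {ι Ω : Type*} [MeasurableSpace Ω] (P : Measure Ω) (K : ℝ) (τ : ℝ → ℝ)
    (u : ι → Ω → ℝ) : Prop where
  indep : iIndepFun u P
  meas : ∀ i, Measurable (u i)
  memLp : ∀ i, MemLp (u i) 2 P
  mean : ∀ i, ∫ ω, u i ω ∂P = 0
  sq_le : ∀ i, ∫ ω, u i ω ^ 2 ∂P ≤ K
  tail : ∀ i T, 0 < T → ∫ ω, tailSq T (u i ω) ∂P ≤ τ T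

theorem tailSq_le_rpow {q T : ℝ} (hq : 0 < q) (hT : 0 < T) (v : ℝ) :
    tailSq T v ≤ T ^ (-q) * |v| ^ (2 + q) := by
  unfold tailSq
  split_ifs with h
  · have h1 : 1 ≤ T ^ (-q) * |v| ^ q := by
      rw [Real.rpow_neg hT.le, ← div_eq_inv_mul, one_le_div (Real.rpow_pos_of_pos hT q)]
      exact Real.rpow_le_rpow hT.le h.le hq.le
    rw [Real.rpow_add (hT.trans h), Real.rpow_two, sq_abs]
    nlinarith [sq_nonneg v]
  · positivity

/-- The remainder is of order `min (x ^ 2) (|x| ^ 3)`: the first bound serves for large errors, the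
second one for the others. -/
theorem norm_exp_mul_I_sub_taylor_le (x : ℝ) :
    ‖Complex.exp (x * Complex.I) - (1 + x * Complex.I - x ^ 2 / 2)‖ ≤ 4 * x ^ 2 ∧
    ‖Complex.exp (x * Complex.I) - (1 + x * Complex.I - x ^ 2 / 2)‖ ≤ 4 * |x| ^ 3 := by
  rcases le_or_gt |x| 1 with h | h
  · have hn : ‖(x * Complex.I : ℂ)‖ = |x| := by simp
    have hb := Complex.exp_bound (x := x * Complex.I) (by rwa [hn]) (n := 3) (by norm_num)
    rw [hn] at hb
    have hs : ∑ m ∈ Finset.range 3, (x * Complex.I : ℂ) ^ m / (m.factorial : ℂ) =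
        1 + x * Complex.I - x ^ 2 / 2 := by
      simp [Finset.sum_range_succ, Nat.factorial, mul_pow]
      ring
    rw [hs] at hb
    have h3 : |x| ^ 3 ≤ x ^ 2 := by
      rw [← sq_abs x]
      exact pow_le_pow_of_le_one (abs_nonneg x) h (by norm_num)
    have h4 : 0 ≤ |x| ^ 3 := by positivity
    have h5 : |x| ^ 3 * (((3 : ℕ).succ : ℝ) * ((Nat.factorial 3 : ℕ) * (3 : ℕ) : ℝ)⁻¹) ≤ |x| ^ 3 := by
      apply mul_le_of_le_one_right h4
      norm_num [Nat.factorial]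
    constructor <;> linarith
  · have h1 : ‖Complex.exp (x * Complex.I) - (1 + x * Complex.I - x ^ 2 / 2)‖ ≤
        1 + (1 + |x| + x ^ 2 / 2) := by
      refine (norm_sub_le _ _).trans (add_le_add (Complex.norm_exp_ofReal_mul_I x).le ?_)
      refine (norm_sub_le _ _).trans (add_le_add ((norm_add_le _ _).trans ?_) ?_)
      · simp
      · simp
    have hx : x ^ 2 = |x| ^ 2 := (sq_abs x).symm
    constructor
    · nlinarith
    · nlinarith [mul_pos (sub_pos.2 h) (sub_pos.2 h), sq_nonneg |x|]

theorem CenteredErrors.integrable_sq {ι Ω : Type*} [MeasurableSpace Ω] {P : Measure Ω}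
    {K : ℝ} {τ : ℝ → ℝ} {u : ι → Ω → ℝ} (hu : CenteredErrors P K τ u) (i : ι) :
    Integrable (fun ω => u i ω ^ 2) P := (hu.memLp i).integrable_sq

theorem CenteredErrors.integrable_tailSq {ι Ω : Type*} [MeasurableSpace Ω] {P : Measure Ω}
    {K : ℝ} {τ : ℝ → ℝ} {u : ι → Ω → ℝ} (hu : CenteredErrors P K τ u) (i : ι) (T : ℝ) :
    Integrable (fun ω => tailSq T (u i ω)) P :=
  (hu.integrable_sq i).mono' ((measurable_tailSq T).comp (hu.meas i)).aestronglyMeasurable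
    (ae_of_all _ fun ω => by
      rw [Real.norm_of_nonneg (tailSq_nonneg _ _)]
      exact tailSq_le _ _)

/-- Second order expansion of a characteristic function, with a remainder of Lindeberg's form. -/
theorem norm_charFun_sub_taylor_le {Ω : Type*} [MeasurableSpace Ω] {P : Measure Ω}
    [IsProbabilityMeasure P] {X : Ω → ℝ} (hXm : Measurable X) (hX : MemLp X 2 P)
    (h0 : ∫ ω, X ω ∂P = 0) (s : ℝ) {T : ℝ} (hT : 0 < T) :
    ‖charFun (P.map X) s - ((1 - s ^ 2 * (∫ ω, X ω ^ 2 ∂P) / 2 : ℝ) : ℂ)‖ ≤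
      4 * s ^ 2 * (|s| * T * (∫ ω, X ω ^ 2 ∂P) + ∫ ω, tailSq T (X ω) ∂P) := by
  have hi1 : Integrable X P := hX.integrable (by norm_num)
  have hi2 : Integrable (fun ω => X ω ^ 2) P := hX.integrable_sq
  have hi3 : Integrable (fun ω => tailSq T (X ω)) P :=
    hi2.mono' ((measurable_tailSq T).comp hXm).aestronglyMeasurable
      (ae_of_all _ fun ω => by
        rw [Real.norm_of_nonneg (tailSq_nonneg _ _)]
        exact tailSq_le _ _)
  have hie : Integrable (fun ω => Complex.exp (((s * X ω : ℝ) : ℂ) * Complex.I)) P := by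
    refine Integrable.mono' (integrable_const (1 : ℝ)) ?_ (ae_of_all _ fun ω => ?_)
    · exact (by fun_prop : Measurable _).aestronglyMeasurable
    · rw [Complex.norm_exp_ofReal_mul_I]
  have hr : Integrable (fun ω => 1 - s ^ 2 * X ω ^ 2 / 2) P :=
    (integrable_const _).sub ((hi2.const_mul _).div_const _)
  have hq : Integrable (fun ω => (1 + ((s * X ω : ℝ) : ℂ) * Complex.I -
      ((s * X ω : ℝ) : ℂ) ^ 2 / 2)) P := by
    have : Integrable (fun ω => ((1 - s ^ 2 * X ω ^ 2 / 2 : ℝ) : ℂ) +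
      ((s * X ω : ℝ) : ℂ) * Complex.I) P := hr.ofReal.add ((hi1.const_mul s).ofReal.mul_const _)
    refine this.congr (ae_of_all _ fun ω => ?_)
    push_cast
    ring
  have hqi : ∫ ω, (1 + ((s * X ω : ℝ) : ℂ) * Complex.I - ((s * X ω : ℝ) : ℂ) ^ 2 / 2) ∂P =
      ((1 - s ^ 2 * (∫ ω, X ω ^ 2 ∂P) / 2 : ℝ) : ℂ) := by
    have e : ∀ ω, (1 + ((s * X ω : ℝ) : ℂ) * Complex.I - ((s * X ω : ℝ) : ℂ) ^ 2 / 2) =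
        ((1 - s ^ 2 * X ω ^ 2 / 2 : ℝ) : ℂ) + ((s * X ω : ℝ) : ℂ) * Complex.I := fun ω => by
      push_cast
      ring
    simp_rw [e]
    rw [integral_add hr.ofReal ((hi1.const_mul s).ofReal.mul_const _), integral_mul_const,
      integral_complex_ofReal, integral_complex_ofReal, integral_const_mul, h0,
      integral_sub (integrable_const _) ((hi2.const_mul _).div_const _), integral_div,
      integral_const_mul]
    simp
  rw [charFun_apply_real, integral_map hXm.aemeasurable
    (by exact (by fun_prop : Measurable _).aestronglyMeasurable), ← hqi]
  have hce : (fun ω => Complex.exp ((s : ℂ) * (X ω : ℂ) * Complex.I)) =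
      fun ω => Complex.exp (((s * X ω : ℝ) : ℂ) * Complex.I) := by
    funext ω; push_cast; rfl
  rw [hce, ← integral_sub hie hq, mul_add, ← mul_assoc, ← integral_const_mul, ← integral_const_mul,
    ← integral_add (hi2.const_mul _) (hi3.const_mul _)]
  refine norm_integral_le_of_norm_le ((hi2.const_mul _).add (hi3.const_mul _))
    (ae_of_all _ fun ω => ?_)
  obtain ⟨h1, h2⟩ := norm_exp_mul_I_sub_taylor_le (s * X ω)
  by_cases hω : T < |X ω|
  · refine h1.trans ?_
    have : tailSq T (X ω) = X ω ^ 2 := if_pos hω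
    simp only [this]
    have : 0 ≤ 4 * s ^ 2 * (|s| * T) * X ω ^ 2 := by positivity
    nlinarith
  · refine h2.trans ?_
    have : tailSq T (X ω) = 0 := if_neg hω
    simp only [this]
    push Not at hω
    have e : |s * X ω| ^ 3 = s ^ 2 * |s| * (|X ω| * X ω ^ 2) := by
      rw [abs_mul, ← sq_abs s, ← sq_abs (X ω)]; ring
    rw [e]
    have h3 : |X ω| * X ω ^ 2 ≤ T * X ω ^ 2 := mul_le_mul_of_nonneg_right hω (sq_nonneg _)
    have h4 : 0 ≤ s ^ 2 * |s| := by positivity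
    have := mul_le_mul_of_nonneg_left h3 h4
    nlinarith

theorem norm_prod_sub_prod_le {ι : Type*} (s : Finset ι) (z w : ι → ℂ)
    (hz : ∀ i, ‖z i‖ ≤ 1) (hw : ∀ i, ‖w i‖ ≤ 1) :
    ‖∏ i ∈ s, z i - ∏ i ∈ s, w i‖ ≤ ∑ i ∈ s, ‖z i - w i‖ := by
  classical
  induction s using Finset.induction_on with
  | empty => simp
  | insert a s ha ih =>
    rw [Finset.prod_insert ha, Finset.prod_insert ha, Finset.sum_insert ha]
    have e : z a * ∏ i ∈ s, z i - w a * ∏ i ∈ s, w i =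
        (z a - w a) * ∏ i ∈ s, z i + w a * (∏ i ∈ s, z i - ∏ i ∈ s, w i) := by ring
    rw [e]
    refine (norm_add_le _ _).trans (add_le_add ?_ ?_)
    · rw [norm_mul]
      refine mul_le_of_le_one_right (norm_nonneg _) ?_
      rw [norm_prod]
      exact Finset.prod_le_one (fun i _ => norm_nonneg _) fun i _ => hz i
    · rw [norm_mul]
      exact (mul_le_of_le_one_left (norm_nonneg _) (hw a)).trans ih

theorem abs_exp_neg_sub_le {x : ℝ} (hx : 0 ≤ x) : |Real.exp (-x) - (1 - x)| ≤ x ^ 2 := by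
  have h1 := Real.add_one_le_exp (-x)
  have h2 : Real.exp (-x) ≤ 1 - x + x ^ 2 := by
    rw [Real.exp_neg]
    have h3 := Real.add_one_le_exp x
    have h4 : (Real.exp x)⁻¹ ≤ (x + 1)⁻¹ := inv_anti₀ (by linarith) h3
    refine h4.trans ?_
    rw [inv_le_iff_one_le_mul₀ (by linarith)]
    nlinarith [pow_nonneg hx 3]
  rw [abs_le]
  constructor <;> linarith

/-- A quantitative Lindeberg theorem for the characteristic function of a weighted sum with unit
variance. -/
theorem CenteredErrors.norm_charFun_sum_sub_le {ι Ω : Type*} [Fintype ι] [MeasurableSpace Ω]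
    {P : Measure Ω} [IsProbabilityMeasure P] {K : ℝ} {τ : ℝ → ℝ} {u : ι → Ω → ℝ}
    (hu : CenteredErrors P K τ u) (hK : 0 ≤ K) {a : ι → ℝ} {ρ V : ℝ} (ha : ∀ i, |a i| ≤ ρ)
    (hV : ∑ i, a i ^ 2 ≤ V) (hvar : ∑ i, a i ^ 2 * ∫ ω, u i ω ^ 2 ∂P = 1)
    (t : ℝ) {T : ℝ} (hT : 0 < T) :
    ‖charFun (P.map fun ω => ∑ i, a i * u i ω) t - Complex.exp (-t ^ 2 / 2)‖ ≤
      (4 * t ^ 2 * (ρ * |t| * T * K + τ T) + t ^ 4 * ρ ^ 2 * K ^ 2) * V := by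
  set v : ι → ℝ := fun i => ∫ ω, u i ω ^ 2 ∂P with hv
  have hv0 : ∀ i, 0 ≤ v i := fun i => integral_nonneg fun ω => sq_nonneg _
  have hindep : iIndepFun (fun i ω => a i * u i ω) P :=
    hu.indep.comp (fun i x => a i * x) fun i => by fun_prop
  rw [hindep.charFun_map_fun_sum_eq_prod fun i => ((hu.meas i).const_mul _).aemeasurable]
  have hexp : Complex.exp (-t ^ 2 / 2) =
      ∏ i, ((Real.exp (-(t ^ 2 * a i ^ 2 * v i / 2)) : ℝ) : ℂ) := by
    have : ∑ i, -(t ^ 2 * a i ^ 2 * v i / 2) = -t ^ 2 / 2 := by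
      rw [Finset.sum_neg_distrib, ← Finset.sum_div]
      simp_rw [mul_assoc]
      rw [← Finset.mul_sum, hvar]
      ring
    rw [← Complex.ofReal_prod, ← Real.exp_sum, this, Complex.ofReal_exp]
    push_cast
    rfl
  rw [hexp, Finset.prod_apply]
  refine (norm_prod_sub_prod_le _ _ _ (fun i => ?_) (fun i => ?_)).trans ?_
  · have := Measure.isProbabilityMeasure_map (μ := P)
      (f := fun ω => a i * u i ω) ((hu.meas i).const_mul _).aemeasurable
    exact norm_charFun_le_one _
  · rw [Complex.norm_real, Real.norm_of_nonneg (Real.exp_nonneg _), Real.exp_le_one_iff]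
    have := hv0 i
    have : 0 ≤ t ^ 2 * a i ^ 2 * v i / 2 := by positivity
    linarith
  rcases isEmpty_or_nonempty ι with he | ⟨⟨i0⟩⟩
  · simp at hvar
  have hρ : 0 ≤ ρ := (abs_nonneg _).trans (ha i0)
  have hτ : 0 ≤ τ T := (integral_nonneg fun ω => tailSq_nonneg _ _).trans (hu.tail i0 T hT)
  have hterm : ∀ i, ‖charFun (P.map fun ω => a i * u i ω) t -
      ((Real.exp (-(t ^ 2 * a i ^ 2 * v i / 2)) : ℝ) : ℂ)‖ ≤
      (4 * t ^ 2 * (ρ * |t| * T * K + τ T) + t ^ 4 * ρ ^ 2 * K ^ 2) * a i ^ 2 := by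
    intro i
    rw [charFun_map_mul_comp (hu.meas i).aemeasurable]
    have h1 := norm_charFun_sub_taylor_le (hu.meas i) (hu.memLp i) (hu.mean i) (a i * t) hT
    have hx : (0 : ℝ) ≤ t ^ 2 * a i ^ 2 * v i / 2 := by
      have := hv0 i
      positivity
    have h2 := abs_exp_neg_sub_le hx
    have h3 : ‖(((1 - (a i * t) ^ 2 * v i / 2 : ℝ)) : ℂ) -
        ((Real.exp (-(t ^ 2 * a i ^ 2 * v i / 2)) : ℝ) : ℂ)‖ ≤ (t ^ 2 * a i ^ 2 * v i / 2) ^ 2 := by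
      rw [← Complex.ofReal_sub, Complex.norm_real, Real.norm_eq_abs, abs_sub_comm]
      convert h2 using 3
      ring
    refine (norm_sub_le_norm_sub_add_norm_sub _ _ _).trans ((add_le_add h1 h3).trans ?_)
    rw [add_mul]
    have hvK : v i ≤ K := hu.sq_le i
    have hv0i := hv0 i
    have hai : a i ^ 2 ≤ ρ ^ 2 := by
      rw [← sq_abs]
      exact pow_le_pow_left₀ (abs_nonneg _) (ha i) 2
    refine add_le_add ?_ ?_
    · have e : 4 * t ^ 2 * (ρ * |t| * T * K + τ T) * a i ^ 2 =
          4 * (a i * t) ^ 2 * (ρ * |t| * T * K + τ T) := by ring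
      rw [e]
      refine mul_le_mul_of_nonneg_left (add_le_add ?_ (hu.tail i T hT)) (by positivity)
      rw [abs_mul]
      have := ha i
      gcongr
    · calc (t ^ 2 * a i ^ 2 * v i / 2) ^ 2 = t ^ 4 * a i ^ 2 * v i ^ 2 * a i ^ 2 / 4 := by ring
        _ ≤ t ^ 4 * ρ ^ 2 * K ^ 2 * a i ^ 2 / 4 := by gcongr
        _ ≤ t ^ 4 * ρ ^ 2 * K ^ 2 * a i ^ 2 := by
          have : 0 ≤ t ^ 4 * ρ ^ 2 * K ^ 2 * a i ^ 2 := by positivity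
          linarith
  refine (Finset.sum_le_sum fun i _ => hterm i).trans ?_
  rw [← Finset.mul_sum]
  exact mul_le_mul_of_nonneg_left hV (by positivity)

/-! ### Quadratic forms in independent errors -/

theorem integral_abs_le_sqrt {Ω : Type*} [MeasurableSpace Ω] {P : Measure Ω}
    [IsProbabilityMeasure P] {X : Ω → ℝ} (hX : MemLp X 2 P) :
    ∫ ω, |X ω| ∂P ≤ √(∫ ω, X ω ^ 2 ∂P) := by
  have h1 := variance_nonneg (fun ω => |X ω|) P
  rw [variance_eq_sub (by exact hX.abs)] at h1
  simp only [Pi.pow_apply, sq_abs] at h1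
  exact Real.le_sqrt_of_sq_le (by linarith)

namespace CenteredErrors

variable {ι Ω : Type*} [MeasurableSpace Ω] {P : Measure Ω} [IsProbabilityMeasure P] {K : ℝ}
  {τ : ℝ → ℝ} {u : ι → Ω → ℝ}

omit [IsProbabilityMeasure P] in
theorem memLp_sum (hu : CenteredErrors P K τ u) (s : Finset ι) (c : ι → ℝ) :
    MemLp (fun ω => ∑ i ∈ s, c i * u i ω) 2 P :=
  memLp_finsetSum s fun i _ => (hu.memLp i).const_mul (c i)

theorem integral_sum_sq (hu : CenteredErrors P K τ u) (s : Finset ι) (c : ι → ℝ) :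
    ∫ ω, (∑ i ∈ s, c i * u i ω) ^ 2 ∂P = ∑ i ∈ s, c i ^ 2 * ∫ ω, u i ω ^ 2 ∂P := by
  have hint : ∀ i, Integrable (u i) P := fun i => (hu.memLp i).integrable (by norm_num)
  have h0 : ∫ ω, (∑ i ∈ s, c i * u i ω) ∂P = 0 := by
    rw [integral_finsetSum s fun i _ => (hint i).const_mul _]
    refine Finset.sum_eq_zero fun i _ => ?_
    rw [integral_const_mul, hu.mean, mul_zero]
  have h1 := variance_of_integral_eq_zero (hu.memLp_sum s c).aemeasurable h0
  have h2 := IndepFun.variance_sum (μ := P) (X := fun i ω => c i * u i ω) (s := s)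
    (fun i _ => (hu.memLp i).const_mul _)
    (fun i _ j _ hij => (hu.indep.indepFun hij).comp (φ := fun x => c i * x) (ψ := fun x => c j * x)
      (by fun_prop) (by fun_prop))
  have e : (∑ i ∈ s, fun ω => c i * u i ω) = fun ω => ∑ i ∈ s, c i * u i ω := by
    ext ω; simp
  rw [e, h1] at h2
  rw [h2]
  refine Finset.sum_congr rfl fun i _ => ?_
  rw [variance_const_mul, variance_of_integral_eq_zero (hu.meas i).aemeasurable (hu.mean i)]

theorem integral_sum_sq_le (hu : CenteredErrors P K τ u) (s : Finset ι) (c : ι → ℝ) :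
    ∫ ω, (∑ i ∈ s, c i * u i ω) ^ 2 ∂P ≤ K * ∑ i ∈ s, c i ^ 2 := by
  rw [hu.integral_sum_sq, Finset.mul_sum]
  refine Finset.sum_le_sum fun i _ => ?_
  rw [mul_comm]
  exact mul_le_mul_of_nonneg_right (hu.sq_le i) (sq_nonneg _)

/-- Decoupling off the diagonal: adding one index `i` to the sum adds a term `u i * L` with `L`
independent of `u i`, which is orthogonal to the sum over the earlier indices. -/
theorem memLp_offDiag_and_integral_sq_le (hu : CenteredErrors P K τ u) (hK : 0 ≤ K)
    {B : ι → ι → ℝ} (hB : ∀ i, B i i = 0) (s : Finset ι) :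
    MemLp (fun ω => ∑ j ∈ s, ∑ l ∈ s, B j l * (u j ω * u l ω)) 2 P ∧
    ∫ ω, (∑ j ∈ s, ∑ l ∈ s, B j l * (u j ω * u l ω)) ^ 2 ∂P ≤
      2 * K ^ 2 * ∑ j ∈ s, ∑ l ∈ s, B j l ^ 2 := by
  classical
  induction s using Finset.induction_on with
  | empty => simp
  | insert i s hi ih =>
    set Q : Ω → ℝ := fun ω => ∑ j ∈ s, ∑ l ∈ s, B j l * (u j ω * u l ω) with hQ
    set L : Ω → ℝ := fun ω => ∑ l ∈ s, (B i l + B l i) * u l ω with hL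
    have hdec : (fun ω => ∑ j ∈ insert i s, ∑ l ∈ insert i s, B j l * (u j ω * u l ω)) =
        fun ω => Q ω + L ω * u i ω := by
      funext ω
      simp only [Finset.sum_insert hi, hB, hQ, hL, add_mul, Finset.sum_mul, zero_mul, zero_add,
        Finset.sum_add_distrib]
      have e1 : ∀ l, B i l * (u i ω * u l ω) = B i l * u l ω * u i ω := fun l => by ring
      have e2 : ∀ l, B l i * (u l ω * u i ω) = B l i * u l ω * u i ω := fun l => by ring
      simp only [e1, e2]
      ring
    have hind : IndepFun (fun ω (j : s) => u j ω) (u i) P := by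
      have h := hu.indep.indepFun_finset s {i} (Finset.disjoint_singleton_right.2 hi) hu.meas
      exact h.comp (φ := id) (ψ := fun v : ({i} : Finset ι) → ℝ =>
        v ⟨i, Finset.mem_singleton_self i⟩) measurable_id (by fun_prop)
    have hQm : Q = (fun v : s → ℝ => ∑ j : s, ∑ l : s, B j l * (v j * v l)) ∘
        (fun ω (j : s) => u j ω) := by
      funext ω
      simp only [hQ, Function.comp]
      rw [← Finset.sum_coe_sort s]
      refine Finset.sum_congr rfl fun j _ => ?_
      rw [← Finset.sum_coe_sort s]
    have hLm : L = (fun v : s → ℝ => ∑ l : s, (B i l + B l i) * v l) ∘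
        (fun ω (j : s) => u j ω) := by
      funext ω
      simp only [hL, Function.comp]
      rw [← Finset.sum_coe_sort s]
    have hLu : IndepFun L (u i) P := by
      rw [hLm]
      exact hind.comp (by fun_prop) measurable_id
    have hL2u : IndepFun (fun ω => L ω ^ 2) (fun ω => u i ω ^ 2) P :=
      hLu.comp (φ := fun x => x ^ 2) (ψ := fun x => x ^ 2) (by fun_prop) (by fun_prop)
    have hQLu : IndepFun (fun ω => Q ω * L ω) (u i) P := by
      rw [hQm, hLm]
      exact hind.comp (φ := fun v : s → ℝ =>
        (∑ j : s, ∑ l : s, B j l * (v j * v l)) * ∑ l : s, (B i l + B l i) * v l) (by fun_prop)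
        measurable_id
    obtain ⟨hQ2, hQle⟩ := ih
    have hL2 : MemLp L 2 P := hu.memLp_sum s _
    have hui : Integrable (u i) P := (hu.memLp i).integrable (by norm_num)
    have hsq : Integrable (fun ω => (L ω * u i ω) ^ 2) P := by
      have := hL2u.integrable_mul hL2.integrable_sq (hu.integrable_sq i)
      refine this.congr (ae_of_all _ fun ω => ?_)
      simp [mul_pow]
    have hLu2 : MemLp (fun ω => L ω * u i ω) 2 P := by
      exact (memLp_two_iff_integrable_sq (hL2.1.mul (hu.memLp i).1)).2 hsq
    have hQL : Integrable (fun ω => Q ω * L ω) P := hQ2.integrable_mul hL2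
    have hQLui : Integrable (fun ω => Q ω * L ω * u i ω) P := hQLu.integrable_mul hQL hui
    have hcross : ∫ ω, Q ω * L ω * u i ω ∂P = 0 := by
      rw [hQLu.integral_fun_mul_eq_mul_integral hQL.1 hui.1, hu.mean, mul_zero]
    have hsqi : ∫ ω, (L ω * u i ω) ^ 2 ∂P = (∫ ω, L ω ^ 2 ∂P) * ∫ ω, u i ω ^ 2 ∂P := by
      simp only [mul_pow]
      exact hL2u.integral_fun_mul_eq_mul_integral hL2.integrable_sq.1 (hu.integrable_sq i).1
    have e : (fun ω => (Q ω + L ω * u i ω) ^ 2) =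
        fun ω => Q ω ^ 2 + 2 * (Q ω * L ω * u i ω) + (L ω * u i ω) ^ 2 := by
      funext ω; ring
    rw [show (fun ω => (∑ j ∈ insert i s, ∑ l ∈ insert i s, B j l * (u j ω * u l ω)) ^ 2) =
      fun ω => (Q ω + L ω * u i ω) ^ 2 from by
        funext ω; rw [← congrFun hdec ω], hdec]
    refine ⟨hQ2.add hLu2, ?_⟩
    have hi1 : Integrable (fun ω => Q ω ^ 2 + 2 * (Q ω * L ω * u i ω)) P :=
      hQ2.integrable_sq.add (hQLui.const_mul 2)
    rw [e, integral_add hi1 hsq,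
      integral_add hQ2.integrable_sq (hQLui.const_mul 2), integral_const_mul, hcross, hsqi]
    have hL' : ∫ ω, L ω ^ 2 ∂P ≤ K * (2 * ∑ l ∈ s, B i l ^ 2 + 2 * ∑ l ∈ s, B l i ^ 2) := by
      refine (hu.integral_sum_sq_le s _).trans (mul_le_mul_of_nonneg_left ?_ hK)
      rw [Finset.mul_sum, Finset.mul_sum, ← Finset.sum_add_distrib]
      exact Finset.sum_le_sum fun l _ => by nlinarith [sq_nonneg (B i l - B l i)]
    have hL0 : 0 ≤ ∫ ω, L ω ^ 2 ∂P := integral_nonneg fun ω => sq_nonneg _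
    have hprod := mul_le_mul hL' (hu.sq_le i) (integral_nonneg fun ω => sq_nonneg _)
      (hL0.trans hL')
    simp only [Finset.sum_insert hi, hB, Finset.sum_add_distrib]
    nlinarith

/-- Weak law for weighted squares: truncation, and Chebyshev for the truncated squares. -/
theorem integrable_diag_and_integral_abs_le [Fintype ι] [Nonempty ι] (hu : CenteredErrors P K τ u) {c : ι → ℝ}
    {w V T : ℝ} (hT : 0 < T) (hw : ∀ i, |c i| ≤ w) (hV : ∑ i, |c i| ≤ V) :
    Integrable (fun ω => ∑ i, c i * (u i ω ^ 2 - ∫ ω', u i ω' ^ 2 ∂P)) P ∧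
    ∫ ω, |∑ i, c i * (u i ω ^ 2 - ∫ ω', u i ω' ^ 2 ∂P)| ∂P ≤ 2 * V * τ T + T ^ 2 * √(w * V) := by
  obtain ⟨i0⟩ := ‹Nonempty ι›
  set t : ι → Ω → ℝ := fun i ω => tailSq T (u i ω) with ht
  set v : ι → Ω → ℝ := fun i ω => u i ω ^ 2 - t i ω with hv
  have hti : ∀ i, Integrable (t i) P := fun i => hu.integrable_tailSq i T
  have ht0 : ∀ i, 0 ≤ ∫ ω, t i ω ∂P := fun i => integral_nonneg fun ω => tailSq_nonneg _ _
  have hvm : ∀ i, Measurable (v i) := fun i =>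
    ((hu.meas i).pow_const 2).sub ((measurable_tailSq T).comp (hu.meas i))
  have hvb : ∀ i ω, 0 ≤ v i ω ∧ v i ω ≤ T ^ 2 := by
    intro i ω
    refine ⟨sub_nonneg.2 (tailSq_le _ _), ?_⟩
    simp only [hv, ht, tailSq]
    split_ifs with h
    · simp; positivity
    · push Not at h
      rw [sub_zero, ← sq_abs]
      exact pow_le_pow_left₀ (abs_nonneg _) h 2
  have hv2 : ∀ i, MemLp (v i) 2 P := fun i =>
    MemLp.of_bound (hvm i).aestronglyMeasurable (T ^ 2) (ae_of_all _ fun ω => by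
      rw [Real.norm_of_nonneg (hvb i ω).1]
      exact (hvb i ω).2)
  have hvi : ∀ i, Integrable (v i) P := fun i => (hv2 i).integrable (by norm_num)
  have hvar : ∀ i, Var[v i; P] ≤ T ^ 4 := by
    intro i
    refine (variance_le_expectation_sq (hvm i).aestronglyMeasurable).trans ?_
    have : ∫ ω, (v i ^ 2) ω ∂P ≤ ∫ ω, T ^ 4 ∂P :=
      integral_mono (hv2 i).integrable_sq (integrable_const _) fun ω => by
        have := pow_le_pow_left₀ (hvb i ω).1 (hvb i ω).2 2
        simp only [Pi.pow_apply]
        nlinarith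
    simpa using this
  set X : Ω → ℝ := fun ω => ∑ i, c i * v i ω with hX
  have hX2 : MemLp X 2 P := memLp_finsetSum _ fun i _ => (hv2 i).const_mul _
  have hXvar : Var[X; P] ≤ T ^ 4 * (w * V) := by
    have h2 := IndepFun.variance_sum (μ := P) (X := fun i ω => c i * v i ω) (s := Finset.univ)
      (fun i _ => (hv2 i).const_mul _)
      (fun i _ j _ hij => (hu.indep.indepFun hij).comp
        (φ := fun x => c i * (x ^ 2 - tailSq T x)) (ψ := fun x => c j * (x ^ 2 - tailSq T x))
        (((measurable_id.pow_const 2).sub (measurable_tailSq T)).const_mul _)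
        (((measurable_id.pow_const 2).sub (measurable_tailSq T)).const_mul _))
    have e : (∑ i, fun ω => c i * v i ω) = X := by
      ext ω; simp [hX]
    rw [e] at h2
    rw [h2]
    calc ∑ i, Var[fun ω => c i * v i ω; P] ≤ ∑ i, T ^ 4 * (w * |c i|) := by
          refine Finset.sum_le_sum fun i _ => ?_
          rw [variance_const_mul, mul_comm]
          refine mul_le_mul (hvar i) ?_ (sq_nonneg _) (by positivity)
          rw [← sq_abs, sq]
          exact mul_le_mul_of_nonneg_right (hw i) (abs_nonneg _)
      _ = T ^ 4 * (w * ∑ i, |c i|) := by rw [Finset.mul_sum, Finset.mul_sum]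
      _ ≤ T ^ 4 * (w * V) := by
          have : 0 ≤ w := (abs_nonneg _).trans (hw i0)
          gcongr
  have hXmean : ∫ ω, X ω ∂P = ∑ i, c i * ∫ ω, v i ω ∂P := by
    rw [hX, integral_finsetSum _ fun i _ => (hvi i).const_mul _]
    simp only [integral_const_mul]
  have hdec : ∀ ω, ∑ i, c i * (u i ω ^ 2 - ∫ ω', u i ω' ^ 2 ∂P) =
      (X ω - ∫ ω, X ω ∂P) + ∑ i, c i * (t i ω - ∫ ω, t i ω ∂P) := by
    intro ω
    rw [hXmean, hX]
    simp only
    rw [← Finset.sum_sub_distrib, ← Finset.sum_add_distrib]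
    refine Finset.sum_congr rfl fun i _ => ?_
    have : ∫ ω, v i ω ∂P = ∫ ω', u i ω' ^ 2 ∂P - ∫ ω, t i ω ∂P :=
      integral_sub (hu.integrable_sq i) (hti i)
    rw [this]
    simp only [hv]
    ring
  have hint : Integrable (fun ω => ∑ i, c i * (u i ω ^ 2 - ∫ ω', u i ω' ^ 2 ∂P)) P :=
    integrable_finsetSum _ fun i _ => ((hu.integrable_sq i).sub (integrable_const _)).const_mul _
  refine ⟨hint, ?_⟩
  have hXc : MemLp (fun ω => X ω - ∫ ω, X ω ∂P) 2 P := hX2.sub (memLp_const _)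
  have h1 : ∫ ω, |X ω - ∫ ω, X ω ∂P| ∂P ≤ T ^ 2 * √(w * V) := by
    refine (integral_abs_le_sqrt hXc).trans ?_
    rw [← variance_eq_integral hX2.aemeasurable]
    refine (Real.sqrt_le_sqrt hXvar).trans ?_
    rw [Real.sqrt_mul (by positivity), show T ^ 4 = (T ^ 2) ^ 2 by ring,
      Real.sqrt_sq (by positivity)]
  have hterm : ∀ i, Integrable (fun ω => |c i| * (t i ω + ∫ ω, t i ω ∂P)) P := fun i =>
    ((hti i).add (integrable_const _)).const_mul _
  have h2 : ∫ ω, ∑ i, |c i| * (t i ω + ∫ ω, t i ω ∂P) ∂P ≤ 2 * V * τ T := by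
    rw [integral_finsetSum _ fun i _ => hterm i]
    calc ∑ i, ∫ ω, |c i| * (t i ω + ∫ ω, t i ω ∂P) ∂P = ∑ i, |c i| * (2 * ∫ ω, t i ω ∂P) := by
          refine Finset.sum_congr rfl fun i _ => ?_
          rw [integral_const_mul, integral_add (hti i) (integrable_const _)]
          simp
          ring_nf
          simp
      _ ≤ ∑ i, |c i| * (2 * τ T) := by
          refine Finset.sum_le_sum fun i _ => ?_
          have := hu.tail i T hT
          gcongr
      _ = (∑ i, |c i|) * (2 * τ T) := by rw [Finset.sum_mul]
      _ ≤ 2 * V * τ T := by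
          have : 0 ≤ τ T := (ht0 i0).trans (hu.tail i0 T hT)
          nlinarith
  have hmono : ∫ ω, |∑ i, c i * (u i ω ^ 2 - ∫ ω', u i ω' ^ 2 ∂P)| ∂P ≤
      ∫ ω, (|X ω - ∫ ω, X ω ∂P| + ∑ i, |c i| * (t i ω + ∫ ω, t i ω ∂P)) ∂P := by
    refine integral_mono hint.abs ((hXc.integrable (by norm_num)).abs.add
      (integrable_finsetSum _ fun i _ => hterm i)) fun ω => ?_
    simp only
    rw [hdec]
    refine (abs_add_le _ _).trans (add_le_add le_rfl ?_)
    refine (Finset.abs_sum_le_sum_abs _ _).trans (Finset.sum_le_sum fun i _ => ?_)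
    rw [abs_mul]
    refine mul_le_mul_of_nonneg_left ?_ (abs_nonneg _)
    rw [abs_le]
    have := tailSq_nonneg T (u i ω)
    have := ht0 i
    constructor <;> simp only [ht] at * <;> linarith
  rw [integral_add (hXc.integrable (by norm_num)).abs
    (integrable_finsetSum _ fun i _ => hterm i)] at hmono
  linarith

/-- A quadratic form in independent centered errors, with small and absolutely summable
coefficients, is close in `L¹` to its mean. -/
theorem integrable_quadForm_and_integral_abs_le [Fintype ι] [Nonempty ι] (hu : CenteredErrors P K τ u)
    (hK : 0 ≤ K) {A : ι → ι → ℝ} {w V T : ℝ} (hT : 0 < T) (hw0 : 0 ≤ w)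
    (hw : ∀ i j, |A i j| ≤ w) (hV : ∑ i, ∑ j, |A i j| ≤ V) :
    Integrable (fun ω => ∑ i, ∑ j, A i j * (u i ω * u j ω) - ∑ i, A i i * ∫ ω', u i ω' ^ 2 ∂P) P ∧
    ∫ ω, |∑ i, ∑ j, A i j * (u i ω * u j ω) - ∑ i, A i i * ∫ ω', u i ω' ^ 2 ∂P| ∂P ≤
      2 * V * τ T + T ^ 2 * √(w * V) + √(2 * K ^ 2 * (w * V)) := by
  classical
  set B : ι → ι → ℝ := fun i j => if i = j then 0 else A i j with hB
  have hV' : ∑ i, |A i i| ≤ V := by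
    refine le_trans (Finset.sum_le_sum fun i _ => ?_) hV
    exact Finset.single_le_sum (f := fun j => |A i j|) (fun j _ => abs_nonneg _)
      (Finset.mem_univ i)
  obtain ⟨hDi, hD⟩ := hu.integrable_diag_and_integral_abs_le hT (c := fun i => A i i)
    (fun i => hw i i) hV'
  obtain ⟨hO2, hO⟩ := hu.memLp_offDiag_and_integral_sq_le hK (B := B) (by simp [hB]) Finset.univ
  have hBsum : ∑ i, ∑ j, B i j ^ 2 ≤ w * V := by
    calc ∑ i, ∑ j, B i j ^ 2 ≤ ∑ i, ∑ j, w * |A i j| := by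
          refine Finset.sum_le_sum fun i _ => Finset.sum_le_sum fun j _ => ?_
          have h1 := mul_le_mul_of_nonneg_right (hw i j) (abs_nonneg (A i j))
          rw [← sq, sq_abs] at h1
          simp only [hB]
          split_ifs
          · simp only [ne_eq, OfNat.ofNat_ne_zero, not_false_eq_true, zero_pow]
            positivity
          · exact h1
      _ = w * ∑ i, ∑ j, |A i j| := by simp only [Finset.mul_sum]
      _ ≤ w * V := by gcongr
  have hOabs := (integral_abs_le_sqrt hO2).trans (Real.sqrt_le_sqrt (hO.trans
    (mul_le_mul_of_nonneg_left hBsum (by positivity))))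
  have hOi := hO2.integrable (by norm_num)
  have hdec : ∀ ω, ∑ i, ∑ j, A i j * (u i ω * u j ω) - ∑ i, A i i * ∫ ω', u i ω' ^ 2 ∂P =
      ∑ i, A i i * (u i ω ^ 2 - ∫ ω', u i ω' ^ 2 ∂P) + ∑ i, ∑ j, B i j * (u i ω * u j ω) := by
    intro ω
    rw [← Finset.sum_sub_distrib, ← Finset.sum_add_distrib]
    refine Finset.sum_congr rfl fun i _ => ?_
    have e : ∑ j, A i j * (u i ω * u j ω) =
        A i i * u i ω ^ 2 + ∑ j, B i j * (u i ω * u j ω) := by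
      rw [← Finset.add_sum_erase _ _ (Finset.mem_univ i),
        ← Finset.add_sum_erase (f := fun j => B i j * (u i ω * u j ω)) _ (Finset.mem_univ i)]
      have e2 : ∑ j ∈ Finset.univ.erase i, B i j * (u i ω * u j ω) =
          ∑ j ∈ Finset.univ.erase i, A i j * (u i ω * u j ω) :=
        Finset.sum_congr rfl fun j hj => by
          simp only [hB, if_neg (Finset.ne_of_mem_erase hj).symm]
      rw [e2]
      simp only [hB, if_pos]
      ring
    rw [e]
    ring
  simp only [hdec]
  refine ⟨hDi.add hOi, ?_⟩
  have := integral_mono (μ := P) (hDi.add hOi).abs (hDi.abs.add hOi.abs) fun ω => abs_add_le _ _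
  refine this.trans ?_
  simp only [Pi.add_apply]
  rw [integral_add hDi.abs hOi.abs]
  linarith

end CenteredErrors

/-! ### Uniform normal approximation over intervals -/

/-- Convergence of characteristic functions to that of the standard normal law bounds the
probabilities of all intervals from below, uniformly: Lévy's theorem gives convergence in the
Lévy-Prokhorov metric, and the normal law has a bounded density. -/
theorem eventually_gaussianReal_Icc_le {μ : ℕ → Measure ℝ} [∀ n, IsProbabilityMeasure (μ n)]
    (h : ∀ t : ℝ, Tendsto (fun n => charFun (μ n) t) atTop (𝓝 (Complex.exp (-t ^ 2 / 2))))
    {ε : ℝ} (hε : 0 < ε) :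
    ∀ᶠ n in atTop, ∀ a b : ℝ,
      (gaussianReal 0 1).real (Set.Icc a b) ≤ (μ n).real (Set.Icc a b) + ε := by
  set ν : ℕ → ProbabilityMeasure ℝ := fun n => ⟨μ n, inferInstance⟩
  set γ : ProbabilityMeasure ℝ := ⟨gaussianReal 0 1, inferInstance⟩
  have h1 : Tendsto ν atTop (𝓝 γ) := by
    refine ProbabilityMeasure.tendsto_of_tendsto_charFun fun t => ?_
    have e : charFun (γ : Measure ℝ) t = Complex.exp (-t ^ 2 / 2) := by
      change charFun (gaussianReal 0 1) t = _
      rw [charFun_gaussianReal]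
      simp [neg_div]
    rw [e]
    exact h t
  have h2 : Tendsto (fun n => LevyProkhorov.ofMeasure (ν n)) atTop
      (𝓝 (LevyProkhorov.ofMeasure γ)) :=
    (LevyProkhorov.continuous_ofMeasure_probabilityMeasure.tendsto γ).comp h1
  have hc : 0 < ε / 3 := by linarith
  filter_upwards [EMetric.tendsto_nhds.1 h2 (ENNReal.ofReal (ε / 3)) (by simpa using hc)]
    with n hn a b
  have hn' : levyProkhorovEDist (μ n) (gaussianReal 0 1) < ENNReal.ofReal (ε / 3) := hn
  have h3 := right_measure_le_of_levyProkhorovEDist_lt hn'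
    (B := Set.Icc (a + ε / 3) (b - ε / 3)) measurableSet_Icc
  rw [ENNReal.toReal_ofReal hc.le] at h3
  have hthick : Metric.thickening (ε / 3) (Set.Icc (a + ε / 3) (b - ε / 3)) ⊆ Set.Icc a b := by
    intro z hz
    obtain ⟨y, hy, hzy⟩ := Metric.mem_thickening_iff.1 hz
    rw [Real.dist_eq, abs_lt] at hzy
    exact ⟨by linarith [hy.1], by linarith [hy.2]⟩
  have h4 : (gaussianReal 0 1).real (Set.Icc (a + ε / 3) (b - ε / 3)) ≤
      (μ n).real (Set.Icc a b) + ε / 3 := by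
    have h5 := h3.trans (add_le_add_left (measure_mono (μ := μ n) hthick) _)
    have h6 := ENNReal.toReal_mono (by simp) h5
    rwa [ENNReal.toReal_add (by simp) (by simp), ENNReal.toReal_ofReal hc.le] at h6
  have hsub : Set.Icc a b ⊆ Set.Icc (a + ε / 3) (b - ε / 3) ∪
      (Set.Icc a (a + ε / 3) ∪ Set.Icc (b - ε / 3) b) := by
    intro z hz
    simp only [Set.mem_union, Set.mem_Icc] at *
    by_cases h1 : z ≤ a + ε / 3
    · exact Or.inr (Or.inl ⟨hz.1, h1⟩)
    · by_cases h2 : z ≤ b - ε / 3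
      · exact Or.inl ⟨by linarith, h2⟩
      · exact Or.inr (Or.inr ⟨by linarith, hz.2⟩)
  have k1 := measureReal_mono (μ := gaussianReal 0 1) hsub
  have k2 := measureReal_union_le (μ := gaussianReal 0 1) (Set.Icc (a + ε / 3) (b - ε / 3))
    (Set.Icc a (a + ε / 3) ∪ Set.Icc (b - ε / 3) b)
  have k3 := measureReal_union_le (μ := gaussianReal 0 1)
    (Set.Icc a (a + ε / 3)) (Set.Icc (b - ε / 3) b)
  have k4 := gaussianReal_real_Icc_le (a := a) (b := a + ε / 3) (by linarith)
  have k5 := gaussianReal_real_Icc_le (a := b - ε / 3) (b := b) (by linarith)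
  linarith

/-! ### The modulus problem and its weights -/

theorem exists_pos_mul_le (X : ℝ) {Y : ℝ} (hY : 0 < Y) : ∃ z : ℝ, 0 < z ∧ z ≤ 1 ∧ z * X ≤ Y := by
  refine ⟨min 1 (Y / (|X| + 1)), by positivity, min_le_left _ _, ?_⟩
  have h0 : 0 ≤ min 1 (Y / (|X| + 1)) := by positivity
  have h1 : min 1 (Y / (|X| + 1)) * (|X| + 1) ≤ Y := by
    rw [← le_div_iff₀ (by positivity)]
    exact min_le_right _ _
  nlinarith [le_abs_self X]

/-- First order conditions for the modulus problem. The vector `v` of fitted values may be shrunk by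
`l` and shifted by `t₁` on the treated and by `t₀` on the untreated units, which changes the
objective `L` into `l * L + (t₁ - t₀)`; no such change that respects the constraint may raise it. -/
theorem modulus_first_order {ι : Type*} [Fintype ι] {v s : ι → ℝ} {d : ι → Bool} {L R : ℝ}
    (hs : ∀ i, 0 < s i) (hd : ∃ i, d i = true) (hR : 0 < R)
    (hfeas : ∑ i, v i ^ 2 / s i ≤ R)
    (hopt : ∀ l t₁ t₀ : ℝ, 0 ≤ l → l ≤ 1 →
      ∑ i, (l * v i + if d i = true then t₁ else t₀) ^ 2 / s i ≤ R → l * L + (t₁ - t₀) ≤ L) :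
    ∑ i, v i ^ 2 / s i = R ∧ 0 < (∑ i, if d i = true then v i / s i else 0) ∧
    (∑ i, if d i = true then v i / s i else 0) + (∑ i, if d i = true then 0 else v i / s i) = 0 := by
  set S := ∑ i, v i ^ 2 / s i with hS
  set A₁ := ∑ i, if d i = true then v i / s i else 0 with hA₁
  set A₀ := ∑ i, if d i = true then 0 else v i / s i with hA₀
  set W₁ := ∑ i, if d i = true then 1 / s i else 0 with hW₁
  set W₀ := ∑ i, if d i = true then 0 else 1 / s i with hW₀
  have hexp : ∀ l t₁ t₀ : ℝ, ∑ i, (l * v i + if d i = true then t₁ else t₀) ^ 2 / s i =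
      l ^ 2 * S + 2 * l * (t₁ * A₁ + t₀ * A₀) + t₁ ^ 2 * W₁ + t₀ ^ 2 * W₀ := by
    intro l t₁ t₀
    simp only [hS, hA₁, hA₀, hW₁, hW₀, mul_add, Finset.mul_sum, ← Finset.sum_add_distrib]
    refine Finset.sum_congr rfl fun i _ => ?_
    split_ifs <;> ring
  simp only [hexp] at hopt
  have hW₁pos : 0 < W₁ := by
    obtain ⟨i, hi⟩ := hd
    refine Finset.sum_pos' (fun j _ => ?_) ⟨i, Finset.mem_univ i, ?_⟩
    · have := hs j
      split_ifs <;> positivity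
    · rw [if_pos hi]
      exact one_div_pos.2 (hs i)
  have hW₀nn : 0 ≤ W₀ := Finset.sum_nonneg fun j _ => by
    have := hs j
    split_ifs <;> positivity
  have hbind : S = R := by
    by_contra hne
    have hlt : 0 < R - S := sub_pos.2 (lt_of_le_of_ne hfeas hne)
    obtain ⟨z, hz0, hz1, hz⟩ := exists_pos_mul_le (2 * |A₁| + W₁) hlt
    have := hopt 1 z 0 (by norm_num) le_rfl (by nlinarith [le_abs_self A₁, mul_nonneg hz0.le hW₁pos.le])
    linarith
  refine ⟨hbind, ?_, ?_⟩
  · by_contra! hA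
    obtain ⟨y, hy0, hy1, hy⟩ := exists_pos_mul_le (W₁ / R) (by norm_num : (0:ℝ) < 1 / 2)
    obtain ⟨x, hx0, hx1, hx⟩ := exists_pos_mul_le (W₁ / R * L) (by norm_num : (0:ℝ) < 1 / 2)
    -- shift by `q` and shrink by `1 - e`: the cost of the shift is of the second order in `q`
    set q := min x y with hq
    have hq0 : 0 < q := lt_min hx0 hy0
    have hWR : 0 < W₁ / R := div_pos hW₁pos hR
    set e := q ^ 2 * (W₁ / R) with he
    have he0 : 0 < e := by positivity
    have he1 : e ≤ 1 := by
      have h1 : q * (W₁ / R) ≤ 1 / 2 :=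
        (mul_le_mul_of_nonneg_right (min_le_right _ _) hWR.le).trans hy
      have h2 : q ≤ 1 := (min_le_left _ _).trans hx1
      nlinarith
    have heR : e * R = q ^ 2 * W₁ := by rw [he]; field_simp
    have hcon := hopt (1 - e) q 0 (by linarith) (by linarith) (by
      rw [hbind]
      have : (1 - e) * (q * A₁) ≤ 0 :=
        mul_nonpos_of_nonneg_of_nonpos (by linarith) (mul_nonpos_of_nonneg_of_nonpos hq0.le hA)
      nlinarith [mul_nonneg (mul_nonneg he0.le (sub_nonneg.2 he1)) hR.le])
    have h3 : q ≤ e * L := by linarith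
    have h4 : 1 ≤ q * (W₁ / R * L) := by
      rw [he] at h3
      have : q * 1 ≤ q * (q * (W₁ / R * L)) := by linarith
      exact le_of_mul_le_mul_left this hq0
    rcases le_or_gt 0 L with hL | hL
    · have : q * (W₁ / R * L) ≤ x * (W₁ / R * L) :=
        mul_le_mul_of_nonneg_right (min_le_left _ _) (by positivity)
      linarith
    · have : q * (W₁ / R * L) ≤ 0 :=
        mul_nonpos_of_nonneg_of_nonpos hq0.le (mul_nonpos_of_nonneg_of_nonpos hWR.le hL.le)
      linarith
  · by_contra hne
    have hD : 0 < (A₁ + A₀) ^ 2 := by positivity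
    set D := A₁ + A₀ with hDdef
    -- equal shifts by `-z * D` in both arms relax the constraint to first order, which leaves room to
    -- raise the treated arm by a further `z * c`
    obtain ⟨c, hc0, hc1, hc⟩ := exists_pos_mul_le A₁ (half_pos hD)
    obtain ⟨z, hz0, hz1, hz⟩ := exists_pos_mul_le ((c - D) ^ 2 * W₁ + D ^ 2 * W₀) hD
    have := hopt 1 (z * (c - D)) (z * (-D)) (by norm_num) le_rfl (by
      have e : (1:ℝ) ^ 2 * S + 2 * 1 * (z * (c - D) * A₁ + z * (-D) * A₀) + (z * (c - D)) ^ 2 * W₁ +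
        (z * (-D)) ^ 2 * W₀ = S + z * (2 * (c * A₁ - D ^ 2) +
          z * ((c - D) ^ 2 * W₁ + D ^ 2 * W₀)) := by
        rw [hDdef]; ring
      rw [e]
      have : z * (2 * (c * A₁ - D ^ 2) + z * ((c - D) ^ 2 * W₁ + D ^ 2 * W₀)) ≤ 0 :=
        mul_nonpos_of_nonneg_of_nonpos hz0.le (by linarith)
      linarith)
    nlinarith

theorem FLip.shrink_add_const {E : Type*} [NormedAddCommGroup E] {C : ℝ} {f : E → Bool → ℝ}
    (hf : f ∈ FLip E C) {l : ℝ} (h0 : 0 ≤ l) (h1 : l ≤ 1) (t : Bool → ℝ) :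
    (fun z b => l * f z b + t b) ∈ FLip E C := by
  intro b z z'
  have e : l * f z b + t b - (l * f z' b + t b) = l * (f z b - f z' b) := by ring
  rw [e, abs_mul, abs_of_nonneg h0]
  exact (mul_le_of_le_one_left (abs_nonneg _) h1).trans (hf b z z')

theorem cate_shrink_add_const {E : Type*} {n : ℕ} (hn : 0 < n) (x : Fin n → E) (f : E → Bool → ℝ)
    (l : ℝ) (t : Bool → ℝ) :
    cate x (fun z b => l * f z b + t b) = l * cate x f + (t true - t false) := by
  have hn' : (n : ℝ) ≠ 0 := by positivity
  have e : ∀ i, l * f (x i) true + t true - (l * f (x i) false + t false) =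
      l * (f (x i) true - f (x i) false) + (t true - t false) := fun i => by ring
  simp only [cate, e, Finset.sum_add_distrib, ← Finset.mul_sum, Finset.sum_const, Finset.card_univ,
    Fintype.card_fin, nsmul_eq_mul]
  field_simp

/-- The constraint binds, and the sums of the unnormalized weights over the two arms are opposite
and nonzero, so that the normalization in `optimalWeight` is not a division by zero. -/
theorem IsModulusSolution.first_order {E : Type*} [NormedAddCommGroup E] {n : ℕ} {C δ : ℝ}
    {σtsq : E → Bool → ℝ} {x : Fin n → E} {d : Fin n → Bool} {f : E → Bool → ℝ}
    (hf : IsModulusSolution C δ σtsq x d f) (hδ : 0 < δ) (hσ : ∀ z b, 0 < σtsq z b)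
    (hd : ∃ i, d i = true) :
    ∑ i, f (x i) (d i) ^ 2 / σtsq (x i) (d i) = δ ^ 2 / 4 ∧
    0 < (∑ i, if d i = true then f (x i) (d i) / σtsq (x i) (d i) else 0) ∧
    (∑ i, if d i = true then f (x i) (d i) / σtsq (x i) (d i) else 0) +
      (∑ i, if d i = true then 0 else f (x i) (d i) / σtsq (x i) (d i)) = 0 := by
  obtain ⟨⟨hfL, hfc⟩, hopt⟩ := hf
  have hn : 0 < n := by
    obtain ⟨i, -⟩ := hd
    exact i.pos
  refine modulus_first_order (L := cate x f) (fun i => hσ _ _) hd (by positivity) hfc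
    fun l t₁ t₀ h0 h1 hc => ?_
  have h := hopt (fun z b => l * f z b + (if b = true then t₁ else t₀))
    ⟨FLip.shrink_add_const hfL h0 h1 fun b => if b = true then t₁ else t₀, hc⟩
  rw [cate_shrink_add_const hn x f l fun b => if b = true then t₁ else t₀] at h
  simp at h
  linarith

/-- The treated weights sum to `1` and the untreated weights sum to `-1`. -/
structure IsContrast {n : ℕ} (d : Fin n → Bool) (k : Fin n → ℝ) : Prop where
  treated : (∑ i, if d i = true then k i else 0) = 1
  untreated : (∑ i, if d i = true then 0 else k i) = -1

theorem IsModulusSolution.isContrast {E : Type*} [NormedAddCommGroup E] {n : ℕ} {C δ : ℝ}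
    {σtsq : E → Bool → ℝ} {x : Fin n → E} {d : Fin n → Bool} {f : E → Bool → ℝ}
    (hf : IsModulusSolution C δ σtsq x d f) (hδ : 0 < δ) (hσ : ∀ z b, 0 < σtsq z b)
    (hd : ∃ i, d i = true) : IsContrast d (optimalWeight σtsq x d f) := by
  obtain ⟨-, hpos, hsum⟩ := hf.first_order hδ hσ hd
  constructor
  · have e : ∀ i, (if d i = true then optimalWeight σtsq x d f i else 0) =
        (if d i = true then f (x i) (d i) / σtsq (x i) (d i) else 0) /
          ∑ j, (if d j = true then f (x j) (d j) / σtsq (x j) (d j) else 0) := fun i => by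
      unfold optimalWeight; split_ifs <;> simp
    simp only [e]
    rw [← Finset.sum_div, div_self hpos.ne']
  · have e : ∀ i, (if d i = true then 0 else optimalWeight σtsq x d f i) =
        (if d i = true then 0 else f (x i) (d i) / σtsq (x i) (d i)) /
          ∑ j, (if d j = true then f (x j) (d j) / σtsq (x j) (d j) else 0) := fun i => by
      unfold optimalWeight; split_ifs <;> simp
    simp only [e]
    rw [← Finset.sum_div, div_eq_iff hpos.ne']
    linarith

/-- The optimal weights are asymptotically negligible: the solution is Lipschitz, so a large value
at one unit would force large values at all the units nearby, and violate the constraint. -/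
theorem eventually_optimalWeight_sq_le {E : Type*} [NormedAddCommGroup E] {δ : ℝ} (hδ : 0 < δ)
    {C : ℕ → ℝ} (hC : ∀ n, 0 < C n) {x : (n : ℕ) → Fin n → E} {d : (n : ℕ) → Fin n → Bool}
    (harms : ∀ᶠ n in atTop, (∃ i, d n i = true) ∧ (∃ i, d n i = false))
    (hdens : ∀ η : ℝ, 0 < η → ArmBallsGrow x d (fun n => η / C n))
    {σtsq : E → Bool → ℝ} {a b : ℝ} (ha : 0 < a) (hσt : ∀ z t, a ≤ σtsq z t ∧ σtsq z t ≤ b)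
    {fs : ℕ → E → Bool → ℝ}
    (hfs : ∀ n, (∃ i, d n i = true) → (∃ i, d n i = false) →
      IsModulusSolution (C n) δ σtsq (x n) (d n) (fs n)) {w : ℝ} (hw : 0 < w) :
    ∀ᶠ n in atTop, 0 < ∑ j, optimalWeight σtsq (x n) (d n) (fs n) j ^ 2 ∧
      ∀ i, optimalWeight σtsq (x n) (d n) (fs n) i ^ 2 ≤
        w * ∑ j, optimalWeight σtsq (x n) (d n) (fs n) j ^ 2 := by
  have hb : 0 < b := ha.trans_le ((hσt 0 true).1.trans (hσt 0 true).2)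
  -- the bound `m` on the fitted values that yields the bound `w` on the relative squared weights
  obtain ⟨m, hm0, hm⟩ : ∃ m : ℝ, 0 < m ∧ m ^ 2 / a ^ 2 = w * (δ ^ 2 / 4 / b) :=
    ⟨√(w * (δ ^ 2 / 4 / b) * a ^ 2), by positivity, by
      rw [Real.sq_sqrt (by positivity)]; field_simp⟩
  obtain ⟨M, hM⟩ := exists_nat_gt (δ ^ 2 / 4 / ((m / 2) ^ 2 / b))
  filter_upwards [harms, hdens (m / 2) (half_pos hm0) M] with n hn hball
  obtain ⟨hbind, hpos, -⟩ := (hfs n hn.1 hn.2).first_order hδ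
    (fun z t => ha.trans_le (hσt z t).1) hn.1
  have hLip : fs n ∈ FLip E (C n) := (hfs n hn.1 hn.2).1.1
  set v : Fin n → ℝ := fun i => fs n (x n i) (d n i) with hv
  set s : Fin n → ℝ := fun i => σtsq (x n i) (d n i) with hs
  have hs0 : ∀ i, 0 < s i := fun i => ha.trans_le (hσt _ _).1
  have hsmall : ∀ i, |v i| ≤ m := by
    intro i
    by_contra! hi
    have hbig : ∀ j ∈ armBall (x n) (d n) (m / 2 / C n) i, (m / 2) ^ 2 / b ≤ v j ^ 2 / s j := by
      intro j hj
      simp only [armBall, Finset.mem_filter, Finset.mem_univ, true_and] at hj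
      have h1 : |v j - v i| ≤ m / 2 := by
        have h2 := hLip (d n i) (x n j) (x n i)
        have h3 : C n * ‖x n j - x n i‖ ≤ C n * (m / 2 / C n) :=
          mul_le_mul_of_nonneg_left hj.1 (hC n).le
        rw [mul_div_cancel₀ _ (hC n).ne'] at h3
        simp only [hv, hj.2]
        exact h2.trans h3
      have h4 : m / 2 ≤ |v j| := by
        have h5 := abs_sub_abs_le_abs_sub (v i) (v j)
        rw [abs_sub_comm] at h5
        linarith
      rw [← sq_abs (v j)]
      exact div_le_div₀ (sq_nonneg _) (pow_le_pow_left₀ (by linarith) h4 2) (hs0 j) (hσt _ _).2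
    have h6 : (M : ℝ) * ((m / 2) ^ 2 / b) ≤ δ ^ 2 / 4 := by
      calc (M : ℝ) * ((m / 2) ^ 2 / b)
          ≤ (armBall (x n) (d n) (m / 2 / C n) i).card * ((m / 2) ^ 2 / b) := by
            have : (M : ℝ) ≤ (armBall (x n) (d n) (m / 2 / C n) i).card := by exact_mod_cast hball i
            gcongr
        _ = ∑ j ∈ armBall (x n) (d n) (m / 2 / C n) i, (m / 2) ^ 2 / b := by
            rw [Finset.sum_const, nsmul_eq_mul]
        _ ≤ ∑ j ∈ armBall (x n) (d n) (m / 2 / C n) i, v j ^ 2 / s j := Finset.sum_le_sum hbig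
        _ ≤ ∑ j, v j ^ 2 / s j :=
            Finset.sum_le_sum_of_subset_of_nonneg (Finset.subset_univ _) fun j _ _ =>
              div_nonneg (sq_nonneg _) (hs0 j).le
        _ = δ ^ 2 / 4 := hbind
    rw [div_lt_iff₀ (by positivity)] at hM
    linarith
  set A := ∑ j, (if d n j = true then v j / s j else 0) with hA
  have hk : ∀ i, optimalWeight σtsq (x n) (d n) (fs n) i = v i / s i / A := fun i => rfl
  have hlow : δ ^ 2 / 4 / b / A ^ 2 ≤ ∑ j, (v j / s j / A) ^ 2 := by
    rw [← hbind, Finset.sum_div, Finset.sum_div]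
    refine Finset.sum_le_sum fun j _ => ?_
    rw [div_pow, div_pow]
    refine div_le_div_of_nonneg_right ?_ (sq_nonneg _)
    rw [div_div, sq (s j)]
    exact div_le_div_of_nonneg_left (sq_nonneg _) (mul_pos (hs0 j) (hs0 j))
      (mul_le_mul_of_nonneg_left (hσt _ _).2 (hs0 j).le)
  simp only [hk]
  refine ⟨lt_of_lt_of_le (by positivity) hlow, fun i => ?_⟩
  refine le_trans ?_ (mul_le_mul_of_nonneg_left hlow hw.le)
  rw [← mul_div_assoc, ← hm, div_pow, div_pow]
  refine div_le_div_of_nonneg_right (div_le_div₀ (sq_nonneg _) ?_ (by positivity) ?_) (sq_nonneg _)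
  · rw [← sq_abs (v i)]
    exact pow_le_pow_left₀ (abs_nonneg _) (hsmall i) 2
  · exact pow_le_pow_left₀ ha.le (hσt _ _).1 2

/-- A contrast has finite worst-case bias, which bounds the bias under every regression function. -/
theorem IsContrast.abs_bias_le_maxBias {E : Type*} [NormedAddCommGroup E] {n : ℕ} {C : ℝ}
    {x : Fin n → E} {d : Fin n → Bool} {k : Fin n → ℝ} (hk : IsContrast d k)
    {f : E → Bool → ℝ} (hf : f ∈ FLip E C) :
    |∑ i, k i * f (x i) (d i) - cate x f| ≤ maxBias C x d k := by
  have hn : 0 < n := by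
    rcases Nat.eq_zero_or_pos n with rfl | h
    · have := hk.treated
      simp at this
    · exact h
  have hn' : (0 : ℝ) < n := by exact_mod_cast hn
  have hbdd : BddAbove ((fun g : E → Bool → ℝ => ∑ i, k i * g (x i) (d i) - cate x g) ''
      FLip E C) := by
    refine ⟨∑ i, |k i| * (C * ‖x i‖) + 1 / (n : ℝ) * ∑ i, (C * ‖x i‖ + C * ‖x i‖), ?_⟩
    rintro _ ⟨g, hg, rfl⟩
    have hg0 : ∀ z b, |g z b - g 0 b| ≤ C * ‖z‖ := fun z b => by simpa using hg b z 0
    have e1 : ∑ i, k i * g (x i) (d i) =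
        ∑ i, k i * (g (x i) (d i) - g 0 (d i)) + (g 0 true - g 0 false) := by
      have h1 : ∑ i, k i * g 0 (d i) = (∑ i, if d i = true then k i else 0) * g 0 true +
          (∑ i, if d i = true then 0 else k i) * g 0 false := by
        rw [Finset.sum_mul, Finset.sum_mul, ← Finset.sum_add_distrib]
        refine Finset.sum_congr rfl fun i _ => ?_
        cases d i <;> simp
      rw [hk.treated, hk.untreated] at h1
      simp only [mul_sub, Finset.sum_sub_distrib, h1]
      ring
    have e2 : cate x g = 1 / (n : ℝ) * ∑ i, ((g (x i) true - g 0 true) -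
        (g (x i) false - g 0 false)) + (g 0 true - g 0 false) := by
      have h := cate_shrink_add_const hn x g 1 (fun b => - g 0 b)
      simp only [one_mul] at h
      have h2 : cate x (fun z b => g z b + -g 0 b) = 1 / (n : ℝ) * ∑ i, ((g (x i) true - g 0 true) -
        (g (x i) false - g 0 false)) := rfl
      rw [← h2, h]
      ring
    simp only
    rw [e1, e2, add_sub_add_right_eq_sub]
    have h3 : ∑ i, k i * (g (x i) (d i) - g 0 (d i)) ≤ ∑ i, |k i| * (C * ‖x i‖) :=
      Finset.sum_le_sum fun i _ => (le_abs_self _).trans (by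
        rw [abs_mul]
        exact mul_le_mul_of_nonneg_left (hg0 _ _) (abs_nonneg _))
    have h4 : -(1 / (n : ℝ) * ∑ i, ((g (x i) true - g 0 true) - (g (x i) false - g 0 false))) ≤
        1 / (n : ℝ) * ∑ i, (C * ‖x i‖ + C * ‖x i‖) := by
      rw [← mul_neg, ← Finset.sum_neg_distrib]
      refine mul_le_mul_of_nonneg_left (Finset.sum_le_sum fun i _ => ?_) (by positivity)
      have h5 := abs_le.1 (hg0 (x i) true)
      have h6 := abs_le.1 (hg0 (x i) false)
      linarith
    linarith
  rw [abs_le']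
  refine ⟨le_csSup hbdd ⟨f, hf, rfl⟩, le_csSup hbdd ⟨fun z b => - f z b, ?_, ?_⟩⟩
  · intro b z z'
    rw [← neg_sub', abs_neg]
    exact hf b z z'
  · have e : ∀ i, -f (x i) true - -f (x i) false = -(f (x i) true - f (x i) false) := fun i => by
      ring
    simp only [cate, e, mul_neg, Finset.sum_neg_distrib]
    ring

/-! ### Nearest neighbors in finite-dimensional norms -/

/-- On a finite-dimensional space, a definite seminorm is equivalent to the norm. -/
theorem Seminorm.exists_equiv_norm {E : Type*} [NormedAddCommGroup E] [NormedSpace ℝ E]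
    [FiniteDimensional ℝ E] (N : Seminorm ℝ E) (hN : ∀ z, N z = 0 → z = 0) :
    ∃ a b : ℝ, 0 < a ∧ 0 < b ∧ ∀ z, a * ‖z‖ ≤ N z ∧ N z ≤ b * ‖z‖ := by
  have hcont : Continuous N :=
    continuousOn_univ.1 (N.convexOn.continuousOn isOpen_univ)
  obtain ⟨b, hb, hle⟩ := Seminorm.bound_of_continuous_normedSpace N hcont
  suffices h : ∃ a : ℝ, 0 < a ∧ ∀ z, a * ‖z‖ ≤ N z by
    obtain ⟨a, ha, hal⟩ := h
    exact ⟨a, b, ha, hb, fun z => ⟨hal z, hle z⟩⟩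
  rcases (Metric.sphere (0 : E) 1).eq_empty_or_nonempty with he | hne
  · refine ⟨1, one_pos, fun z => ?_⟩
    have hz : ‖z‖ = 0 := by
      by_contra hz
      have : ‖z‖⁻¹ • z ∈ Metric.sphere (0 : E) 1 := by
        simp [norm_smul, inv_mul_cancel₀ hz]
      rw [he] at this
      exact this
    rw [hz]
    simp
  · obtain ⟨z₀, hz₀, hmin⟩ := (isCompact_sphere (0 : E) 1).exists_isMinOn hne hcont.continuousOn
    have hz₀n : ‖z₀‖ = 1 := by simpa using hz₀
    refine ⟨N z₀, lt_of_le_of_ne (apply_nonneg N z₀) fun h => ?_, fun z => ?_⟩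
    · rw [hN z₀ h.symm, norm_zero] at hz₀n
      exact zero_ne_one hz₀n
    · rcases eq_or_ne z 0 with rfl | hz
      · simp
      have hz' : ‖z‖ ≠ 0 := norm_ne_zero_iff.2 hz
      have hmem : ‖z‖⁻¹ • z ∈ Metric.sphere (0 : E) 1 := by
        simp [norm_smul, inv_mul_cancel₀ hz']
      have h1 : N z₀ ≤ N (‖z‖⁻¹ • z) := hmin hmem
      rw [map_smul_eq_mul, norm_inv, norm_norm, inv_mul_eq_div, le_div_iff₀ (by positivity)] at h1
      exact h1

/-- Points with nearby directions, seen from the origin, are closer to each other than the farther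
one is to the origin. -/
theorem Seminorm.sub_lt_of_directions_close {E : Type*} [AddCommGroup E] [Module ℝ E]
    (N : Seminorm ℝ E) {z z' : E} (hz : 0 < N z) (hle : N z ≤ N z')
    (hdir : N ((N z)⁻¹ • z - (N z')⁻¹ • z') < 1) : N (z - z') < N z' := by
  have hz' : 0 < N z' := hz.trans_le hle
  have e : z - z' = N z • ((N z)⁻¹ • z - (N z')⁻¹ • z') + (N z / N z' - 1) • z' := by
    rw [smul_sub, smul_smul, smul_smul, mul_inv_cancel₀ hz.ne', one_smul, sub_smul, one_smul,
      div_eq_mul_inv]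
    abel
  rw [e]
  refine (map_add_le_add N _ _).trans_lt ?_
  rw [map_smul_eq_mul, map_smul_eq_mul, Real.norm_of_nonneg hz.le, Real.norm_eq_abs,
    abs_of_nonpos (sub_nonpos.2 ((div_le_one hz').2 hle))]
  have e2 : -(N z / N z' - 1) * N z' = N z' - N z := by field_simp; ring
  rw [e2]
  nlinarith

theorem Seminorm.exists_finset_directions {E : Type*} [NormedAddCommGroup E] [NormedSpace ℝ E]
    [FiniteDimensional ℝ E] (N : Seminorm ℝ E) (hN : ∀ z, N z = 0 → z = 0) :
    ∃ D : Finset E, ∀ z, N z = 1 → ∃ c ∈ D, N (z - c) < 1 / 2 := by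
  obtain ⟨a, b, ha, hb, hab⟩ := N.exists_equiv_norm hN
  obtain ⟨t, -, htf, hcov⟩ := (isCompact_closedBall (0 : E) a⁻¹).finite_cover_balls
    (show 0 < 1 / (2 * b) by positivity)
  refine ⟨htf.toFinset, fun z hz => ?_⟩
  have hzb : z ∈ Metric.closedBall (0 : E) a⁻¹ := by
    rw [mem_closedBall_zero_iff, ← one_div, le_div_iff₀ ha, mul_comm, ← hz]
    exact (hab z).1
  obtain ⟨c, hc, hzc⟩ := Set.mem_iUnion₂.1 (hcov hzb)
  refine ⟨c, by simpa using hc, (hab _).2.trans_lt ?_⟩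
  rw [mem_ball_iff_norm, lt_div_iff₀ (by positivity)] at hzc
  linarith

open Classical in
/-- A unit is one of the `J` nearest neighbors of boundedly many units at other locations. Split
these units into finitely many cones with apex `j`: in a cone, all the other units are closer to the
farthest unit than `j` is, so they are neighbors of the latter. -/
theorem exists_card_neighborOf_le {E : Type*} [NormedAddCommGroup E] [NormedSpace ℝ E]
    [FiniteDimensional ℝ E] (N : Seminorm ℝ E) (hN : ∀ z, N z = 0 → z = 0) (J : ℕ) :
    ∃ G : ℕ, ∀ (n : ℕ) (x : Fin n → E) (d : Fin n → Bool) (nn : Fin n → Finset (Fin n)),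
      (∀ i, IsNearestNeighbors N x d J i (nn i)) →
      ∀ j, (Finset.univ.filter fun i : Fin n => x i ≠ x j ∧ j ∈ nn i).card ≤ G := by
  obtain ⟨D, hD⟩ := N.exists_finset_directions hN
  refine ⟨J * D.card, fun n x d nn hnn j => ?_⟩
  have hpos : ∀ i, x i ≠ x j → 0 < N (x i - x j) := fun i hi =>
    lt_of_le_of_ne (apply_nonneg N _) fun h => hi (sub_eq_zero.1 (hN _ h.symm))
  have hdir : ∀ i, x i ≠ x j → ∃ c ∈ D, N ((N (x i - x j))⁻¹ • (x i - x j) - c) < 1 / 2 :=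
    fun i hi => hD _ (by
      rw [map_smul_eq_mul, norm_inv, Real.norm_of_nonneg (hpos i hi).le,
        inv_mul_cancel₀ (hpos i hi).ne'])
  choose! φ hφD hφ using hdir
  refine Finset.card_le_mul_card_image_of_maps_to (f := φ)
    (fun i hi => hφD i (Finset.mem_filter.1 hi).2.1) J fun c _ => ?_
  set S := (Finset.univ.filter fun i : Fin n => x i ≠ x j ∧ j ∈ nn i).filter fun i => φ i = c
    with hS
  have hmem : ∀ i ∈ S, x i ≠ x j ∧ j ∈ nn i ∧ φ i = c := fun i hi => by
    simp only [hS, Finset.mem_filter, Finset.mem_univ, true_and] at hi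
    exact ⟨hi.1.1, hi.1.2, hi.2⟩
  rcases S.eq_empty_or_nonempty with he | hne
  · simp [he]
  obtain ⟨m, hm, hmax⟩ := S.exists_max_image (fun i => N (x i - x j)) hne
  obtain ⟨hmx, hmj, hmc⟩ := hmem m hm
  have hsub : S.erase m ⊆ (nn m).erase j := by
    intro i hi
    obtain ⟨him, hiS⟩ := Finset.mem_erase.1 hi
    obtain ⟨hix, hij, hic⟩ := hmem i hiS
    refine Finset.mem_erase.2 ⟨fun h => hix (h ▸ rfl), ?_⟩
    by_contra hnot
    have hdi : d i = d m := ((hnn i).2.1 j hij).2.symm.trans ((hnn m).2.1 j hmj).2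
    have h1 := (hnn m).2.2 j hmj i hnot him hdi
    have hclose : N ((N (x i - x j))⁻¹ • (x i - x j) - (N (x m - x j))⁻¹ • (x m - x j)) < 1 := by
      have h2 := hφ i hix
      have h3 := hφ m hmx
      rw [hic] at h2
      rw [hmc] at h3
      have h4 := map_sub_le_add N ((N (x i - x j))⁻¹ • (x i - x j) - c)
        ((N (x m - x j))⁻¹ • (x m - x j) - c)
      rw [sub_sub_sub_cancel_right] at h4
      linarith
    have h2 := N.sub_lt_of_directions_close (hpos i hix) (hmax i hiS) hclose
    rw [sub_sub_sub_cancel_right, map_sub_rev N (x m)] at h2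
    linarith
  have h1 := Finset.card_le_card hsub
  rw [Finset.card_erase_of_mem hm, Finset.card_erase_of_mem hmj, (hnn m).1] at h1
  have hJ : 0 < J := (hnn m).1 ▸ Finset.card_pos.2 ⟨j, hmj⟩
  omega

/-- If the ball around a unit contains more than `J` units with the same treatment, then its `J`
nearest neighbors in an equivalent norm are almost as close. -/
theorem IsNearestNeighbors.norm_sub_le {E : Type*} [NormedAddCommGroup E] [NormedSpace ℝ E]
    {N : Seminorm ℝ E} {a b : ℝ} (ha : 0 < a) (hb : 0 < b)
    (hab : ∀ z, a * ‖z‖ ≤ N z ∧ N z ≤ b * ‖z‖)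
    {n : ℕ} {x : Fin n → E} {d : Fin n → Bool} {J : ℕ} {i : Fin n} {S : Finset (Fin n)}
    (hS : IsNearestNeighbors N x d J i S) {r : ℝ} (hr : 0 ≤ r)
    (hball : J + 1 ≤ (armBall x d r i).card) {j : Fin n} (hj : j ∈ S) :
    ‖x j - x i‖ ≤ b / a * r := by
  classical
  have hmem : ∀ l, l ∈ armBall x d r i ↔ ‖x l - x i‖ ≤ r ∧ d l = d i := fun l => by
    simp [armBall]
  have hi : i ∈ armBall x d r i := (hmem i).2 ⟨by simpa using hr, rfl⟩
  suffices h : N (x j - x i) ≤ b * r by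
    rw [div_mul_eq_mul_div, le_div_iff₀ ha, mul_comm]
    exact (hab _).1.trans h
  by_cases hex : ∃ l ∈ armBall x d r i, l ∉ S ∧ l ≠ i
  · obtain ⟨l, hl, hlS, hli⟩ := hex
    have hl' := (hmem l).1 hl
    exact (hS.2.2 j hj l hlS hli hl'.2).trans ((hab _).2.trans
      (mul_le_mul_of_nonneg_left hl'.1 hb.le))
  · push Not at hex
    have hsub : (armBall x d r i).erase i ⊆ S := fun l hl => by
      by_contra hlS
      exact Finset.ne_of_mem_erase hl (hex l (Finset.mem_of_mem_erase hl) hlS)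
    have hcard : S.card ≤ ((armBall x d r i).erase i).card := by
      rw [Finset.card_erase_of_mem hi, hS.1]
      omega
    have hj' := (Finset.eq_of_subset_of_card_le hsub hcard) ▸ hj
    exact (hab _).2.trans (mul_le_mul_of_nonneg_left
      ((hmem j).1 (Finset.mem_of_mem_erase hj')).1 hb.le)

/-! ### Errors of the fixed design model -/

theorem FixedDesignModel.centeredErrors {E : Type*} {n : ℕ} {K : ℝ} (hK : 0 < K)
    {σsq : E → Bool → ℝ} {x : Fin n → E} {d : Fin n → Bool} {f : E → Bool → ℝ}
    {P : Measure (Fin n → ℝ)} (h : FixedDesignModel K σsq x d f P) :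
    CenteredErrors P K (fun T => T ^ (-(1 / K)) * K) (fun i y => y i - f (x i) (d i)) where
  indep := h.indep
  meas i := by fun_prop
  memLp i := (memLp_two_iff_integrable_sq
    (by exact (by fun_prop : Measurable _).aestronglyMeasurable)).2 (h.integrable_sq i)
  mean := h.mean
  sq_le := h.variance_upper
  tail i T hT := by
    have h1 : ∫ y : Fin n → ℝ, tailSq T (y i - f (x i) (d i)) ∂P ≤
        ∫ y : Fin n → ℝ, T ^ (-(1 / K)) * |y i - f (x i) (d i)| ^ (2 + 1 / K) ∂P :=
      integral_mono_of_nonneg (ae_of_all _ fun y => tailSq_nonneg _ _)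
        ((h.integrable_moment i).const_mul _)
        (ae_of_all _ fun y => tailSq_le_rpow (by positivity) hT _)
    rw [integral_const_mul] at h1
    exact h1.trans (mul_le_mul_of_nonneg_left (h.moment i) (by positivity))

theorem tendsto_rpow_neg_mul_atTop {K : ℝ} (hK : 0 < K) :
    Tendsto (fun T : ℝ => T ^ (-(1 / K)) * K) atTop (𝓝 0) := by
  simpa using (tendsto_rpow_neg_atTop (one_div_pos.2 hK)).mul_const K

/-- A weighted average of squares changes little in `L¹` under perturbations small in `L²`. -/
theorem integrable_and_integral_abs_sum_add_sq_sub_le {ι Ω : Type*} [Fintype ι] [MeasurableSpace Ω]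
    {P : Measure Ω} {w : ι → ℝ} (hw : ∀ i, 0 ≤ w i) (hw1 : ∑ i, w i = 1)
    {e g : ι → Ω → ℝ} (he : ∀ i, MemLp (e i) 2 P) (hg : ∀ i, MemLp (g i) 2 P) {A B m : ℝ}
    (hA : ∀ i, ∫ ω, e i ω ^ 2 ∂P ≤ A) (hB : ∀ i, ∫ ω, g i ω ^ 2 ∂P ≤ B)
    (hm : Integrable (fun ω => ∑ i, w i * e i ω ^ 2 - m) P) {θ : ℝ} (hθ : 0 < θ) :
    Integrable (fun ω => ∑ i, w i * (e i ω + g i ω) ^ 2 - m) P ∧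
    ∫ ω, |∑ i, w i * (e i ω + g i ω) ^ 2 - m| ∂P ≤
      ∫ ω, |∑ i, w i * e i ω ^ 2 - m| ∂P + (θ * A + (1 + 1 / θ) * B) := by
  have hterm : ∀ i, Integrable (fun ω => w i * (θ * e i ω ^ 2 + (1 + 1 / θ) * g i ω ^ 2)) P :=
    fun i => (((he i).integrable_sq.const_mul θ).add
      ((hg i).integrable_sq.const_mul (1 + 1 / θ))).const_mul _
  have hcross : Integrable (fun ω => ∑ i, w i * (2 * (e i ω * g i ω) + g i ω ^ 2)) P :=
    integrable_finsetSum _ fun i _ =>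
      ((((he i).integrable_mul (hg i)).const_mul 2).add (hg i).integrable_sq).const_mul _
  have hdec : ∀ ω, ∑ i, w i * (e i ω + g i ω) ^ 2 - m =
      (∑ i, w i * e i ω ^ 2 - m) + ∑ i, w i * (2 * (e i ω * g i ω) + g i ω ^ 2) := by
    intro ω
    have : ∀ i, w i * (e i ω + g i ω) ^ 2 =
        w i * e i ω ^ 2 + w i * (2 * (e i ω * g i ω) + g i ω ^ 2) := fun i => by ring
    simp only [this, Finset.sum_add_distrib]
    ring
  simp only [hdec]
  refine ⟨hm.add hcross, ?_⟩
  have h1 : ∫ ω, |(∑ i, w i * e i ω ^ 2 - m) + ∑ i, w i * (2 * (e i ω * g i ω) + g i ω ^ 2)| ∂P ≤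
      ∫ ω, (|∑ i, w i * e i ω ^ 2 - m| +
        ∑ i, w i * (θ * e i ω ^ 2 + (1 + 1 / θ) * g i ω ^ 2)) ∂P := by
    refine integral_mono (hm.add hcross).abs
      (hm.abs.add (integrable_finsetSum _ fun i _ => hterm i)) fun ω => ?_
    refine (abs_add_le _ _).trans (add_le_add le_rfl ?_)
    refine (Finset.abs_sum_le_sum_abs _ _).trans (Finset.sum_le_sum fun i _ => ?_)
    rw [abs_mul, abs_of_nonneg (hw i)]
    refine mul_le_mul_of_nonneg_left ?_ (hw i)
    have h2 : 0 ≤ (θ * e i ω + g i ω) ^ 2 / θ := by positivity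
    have h3 : 0 ≤ (θ * e i ω - g i ω) ^ 2 / θ := by positivity
    have e2 : (θ * e i ω + g i ω) ^ 2 / θ =
        θ * e i ω ^ 2 + 2 * (e i ω * g i ω) + 1 / θ * g i ω ^ 2 := by field_simp; ring
    have e3 : (θ * e i ω - g i ω) ^ 2 / θ =
        θ * e i ω ^ 2 - 2 * (e i ω * g i ω) + 1 / θ * g i ω ^ 2 := by field_simp; ring
    rw [abs_le]
    constructor <;> nlinarith [sq_nonneg (g i ω)]
  rw [integral_add hm.abs (integrable_finsetSum _ fun i _ => hterm i),
    integral_finsetSum _ fun i _ => hterm i] at h1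
  refine h1.trans (add_le_add le_rfl ?_)
  calc ∑ i, ∫ ω, w i * (θ * e i ω ^ 2 + (1 + 1 / θ) * g i ω ^ 2) ∂P
      ≤ ∑ i, w i * (θ * A + (1 + 1 / θ) * B) := by
        refine Finset.sum_le_sum fun i _ => ?_
        rw [integral_const_mul, integral_add ((he i).integrable_sq.const_mul _)
          ((hg i).integrable_sq.const_mul _), integral_const_mul, integral_const_mul]
        refine mul_le_mul_of_nonneg_left (add_le_add ?_ ?_) (hw i)
        · exact mul_le_mul_of_nonneg_left (hA i) hθ.le
        · exact mul_le_mul_of_nonneg_left (hB i) (by positivity)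
    _ = θ * A + (1 + 1 / θ) * B := by rw [← Finset.sum_mul, hw1, one_mul]

/-! ### Errors of the variance estimates at a fixed sample size -/

/-- The nearest-neighbor estimate as the square of a linear combination of the errors `y - v` and a
bias, for arbitrary means `v`. -/
theorem nnResidualSq_eq {n J : ℕ} (nn : Fin n → Finset (Fin n)) (y v : Fin n → ℝ) (i : Fin n) :
    nnResidualSq J nn y i = ((J : ℝ) / (J + 1)) *
      ((∑ j, ((if j = i then 1 else 0) - (if j ∈ nn i then (J : ℝ)⁻¹ else 0)) * (y j - v j)) +
        (v i - (∑ j ∈ nn i, v j) / J)) ^ 2 := by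
  rw [nnResidualSq]
  congr 2
  simp only [sub_mul, ite_mul, one_mul, zero_mul, Finset.sum_sub_distrib, Finset.sum_ite_eq',
    Finset.mem_univ, if_true, ← Finset.sum_filter, Finset.filter_mem_eq_inter, Finset.univ_inter,
    ← Finset.mul_sum]
  ring

theorem sum_sum_sum_mul_eq_sum_mul_sq {ι : Type*} [Fintype ι] (p : ι → ℝ) (M : ι → ι → ℝ) :
    ∑ j, ∑ l, ∑ i, p i * (M i j * M i l) = ∑ i, p i * (∑ j, M i j) ^ 2 := by
  have h : ∀ j, ∑ l, ∑ i, p i * (M i j * M i l) = ∑ i, ∑ l, p i * (M i j * M i l) := fun j =>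
    Finset.sum_comm
  simp only [h]
  rw [Finset.sum_comm]
  refine Finset.sum_congr rfl fun i _ => ?_
  rw [sq, Finset.sum_mul_sum]
  simp only [Finset.mul_sum]

theorem abs_sum_div_card_sub_le {ι : Type*} {S : Finset ι} (hS : S.Nonempty) {v : ι → ℝ} {c β : ℝ}
    (h : ∀ j ∈ S, |v j - c| ≤ β) : |c - (∑ j ∈ S, v j) / (S.card : ℝ)| ≤ β := by
  have hc : (0 : ℝ) < S.card := by exact_mod_cast hS.card_pos
  have e : c - (∑ j ∈ S, v j) / (S.card : ℝ) = -((∑ j ∈ S, (v j - c)) / (S.card : ℝ)) := by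
    rw [Finset.sum_sub_distrib, Finset.sum_const, nsmul_eq_mul]
    field_simp
    ring
  rw [e, abs_neg, abs_div, abs_of_pos hc, div_le_iff₀ hc]
  refine (Finset.abs_sum_le_sum_abs _ _).trans ((Finset.sum_le_sum h).trans ?_)
  rw [Finset.sum_const, nsmul_eq_mul, mul_comm]

/-- The `L¹` error of the weighted nearest-neighbor variance estimates, when each unit is the
neighbor of at most `G` units, and regression and variance functions vary by at most `β` among
neighbors. The squared linear combinations of errors form a quadratic form with coefficients of
order `w G`. -/
theorem CenteredErrors.nnResidualSq_error_le {n : ℕ} {P : Measure (Fin n → ℝ)}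
    [IsProbabilityMeasure P] [Nonempty (Fin n)]
    {K : ℝ} {τ : ℝ → ℝ} (hK : 0 ≤ K) {v : Fin n → ℝ}
    (hu : CenteredErrors P K τ fun i y => y i - v i) {J G : ℕ} (hJ : 1 ≤ J)
    {nn : Fin n → Finset (Fin n)} (hcard : ∀ i, (nn i).card = J) (hne : ∀ i, i ∉ nn i)
    (hG : ∀ j, (Finset.univ.filter fun i : Fin n => j ∈ nn i).card ≤ G)
    {β : ℝ} (hv : ∀ i, ∀ j ∈ nn i, |v j - v i| ≤ β)
    (hσ : ∀ i, ∀ j ∈ nn i, |∫ y, (y j - v j) ^ 2 ∂P - ∫ y, (y i - v i) ^ 2 ∂P| ≤ β)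
    {p : Fin n → ℝ} (hp : ∀ i, 0 ≤ p i) (hp1 : ∑ i, p i = 1) {w : ℝ} (hw : ∀ i, p i ≤ w)
    {T θ : ℝ} (hT : 0 < T) (hθ : 0 < θ) :
    Integrable (fun y => ∑ i, p i * nnResidualSq J nn y i -
      ∑ i, p i * ∫ y', (y' i - v i) ^ 2 ∂P) P ∧
    ∫ y, |∑ i, p i * nnResidualSq J nn y i - ∑ i, p i * ∫ y', (y' i - v i) ^ 2 ∂P| ∂P ≤
      (2 * 4 * τ T + T ^ 2 * √((1 + G) * w * 4) + √(2 * K ^ 2 * ((1 + G) * w * 4))) +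
        (θ * (K * 2) + (1 + 1 / θ) * β ^ 2) + β := by
  obtain ⟨i0⟩ := ‹Nonempty (Fin n)›
  have : Nonempty (Fin n) := ⟨i0⟩
  have hw0 : 0 ≤ w := (hp i0).trans (hw i0)
  have hJ0 : (0 : ℝ) < J := by exact_mod_cast hJ
  have hJ1 : (1 : ℝ) ≤ J := by exact_mod_cast hJ
  set s : Fin n → ℝ := fun i => ∫ y, (y i - v i) ^ 2 ∂P with hs
  set u : Fin n → (Fin n → ℝ) → ℝ := fun i y => y i - v i with hudef
  set κ : ℝ := (J : ℝ) / (J + 1) with hκ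
  have hκ0 : 0 ≤ κ := by positivity
  have hκ1 : κ ≤ 1 := by
    rw [hκ, div_le_one (by positivity)]
    linarith
  set M : Fin n → Fin n → ℝ := fun i j =>
    (if j = i then 1 else 0) - (if j ∈ nn i then (J : ℝ)⁻¹ else 0) with hM
  -- the entries of a row of `M` sum to two in absolute value
  have hMabs : ∀ i j, |M i j| ≤ (if j = i then 1 else 0) + (if j ∈ nn i then (J : ℝ)⁻¹ else 0) := by
    intro i j
    refine (abs_sub _ _).trans (le_of_eq ?_)
    rw [abs_of_nonneg (by split_ifs <;> norm_num), abs_of_nonneg (by split_ifs <;> positivity)]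
  have hrow : ∀ i (q : Fin n → ℝ), ∑ j, (if j ∈ nn i then q j else 0) = ∑ j ∈ nn i, q j := by
    intro i q
    rw [← Finset.sum_filter, Finset.filter_mem_eq_inter, Finset.univ_inter]
  have hMrow : ∀ i, ∑ j, |M i j| ≤ 2 := by
    intro i
    refine (Finset.sum_le_sum fun j _ => hMabs i j).trans (le_of_eq ?_)
    rw [Finset.sum_add_distrib, hrow i fun _ => (J : ℝ)⁻¹, Finset.sum_const, hcard, nsmul_eq_mul,
      mul_inv_cancel₀ hJ0.ne']
    simp
    norm_num
  have hM1 : ∀ i j, |M i j| ≤ 1 := by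
    intro i j
    have hJinv : (J : ℝ)⁻¹ ≤ 1 := inv_le_one_of_one_le₀ hJ1
    refine (hMabs i j).trans ?_
    by_cases h : j = i
    · subst h
      simp [hne]
    · rw [if_neg h]
      split_ifs <;> linarith
  have hMsq : ∀ i (q : Fin n → ℝ), ∑ j, M i j ^ 2 * q j =
      q i + (∑ j ∈ nn i, q j) / (J : ℝ) ^ 2 := by
    intro i q
    have h1 : ∀ j, M i j ^ 2 * q j = (if j = i then q j else 0) +
        (if j ∈ nn i then q j / (J : ℝ) ^ 2 else 0) := by
      intro j
      simp only [hM]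
      by_cases h : j = i
      · subst h
        simp [hne]
      · simp only [if_neg h]
        split_ifs
        · field_simp; ring
        · ring
    simp only [h1, Finset.sum_add_distrib, hrow i fun j => q j / (J : ℝ) ^ 2,
      Finset.sum_ite_eq', Finset.mem_univ, if_true, Finset.sum_div]
  -- the coefficients of the quadratic form
  set A : Fin n → Fin n → ℝ := fun j l => ∑ i, p i * (M i j * M i l) with hA
  have hAw : ∀ j l, |A j l| ≤ (1 + G) * w := by
    intro j l
    calc |A j l| ≤ ∑ i, |p i * (M i j * M i l)| := Finset.abs_sum_le_sum_abs _ _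
      _ ≤ ∑ i, w * ((if i = j then 1 else 0) + (if j ∈ nn i then 1 else 0)) := by
          refine Finset.sum_le_sum fun i _ => ?_
          rw [abs_mul, abs_mul, abs_of_nonneg (hp i)]
          refine mul_le_mul (hw i) ?_ (by positivity) hw0
          refine (mul_le_of_le_one_right (abs_nonneg _) (hM1 i l)).trans ((hMabs i j).trans ?_)
          have hJinv : (J : ℝ)⁻¹ ≤ 1 := inv_le_one_of_one_le₀ hJ1
          refine add_le_add (le_of_eq ?_) ?_
          · simp only [eq_comm]
          · split_ifs
            · exact hJinv
            · exact le_rfl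
      _ = (1 + ((Finset.univ.filter fun i : Fin n => j ∈ nn i).card : ℝ)) * w := by
          rw [← Finset.mul_sum, Finset.sum_add_distrib, Finset.sum_ite_eq',
            if_pos (Finset.mem_univ j), Finset.sum_boole]
          ring
      _ ≤ (1 + G) * w := by
          have : ((Finset.univ.filter fun i : Fin n => j ∈ nn i).card : ℝ) ≤ G := by
            exact_mod_cast hG j
          gcongr
  have hAV : ∑ j, ∑ l, |A j l| ≤ 4 := by
    calc ∑ j, ∑ l, |A j l| ≤ ∑ j, ∑ l, ∑ i, p i * (|M i j| * |M i l|) := by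
          refine Finset.sum_le_sum fun j _ => Finset.sum_le_sum fun l _ => ?_
          refine (Finset.abs_sum_le_sum_abs _ _).trans (le_of_eq ?_)
          refine Finset.sum_congr rfl fun i _ => ?_
          rw [abs_mul, abs_mul, abs_of_nonneg (hp i)]
      _ = ∑ i, p i * (∑ j, |M i j|) ^ 2 := sum_sum_sum_mul_eq_sum_mul_sq p fun i j => |M i j|
      _ ≤ ∑ i, p i * 2 ^ 2 := by
          refine Finset.sum_le_sum fun i _ => mul_le_mul_of_nonneg_left ?_ (hp i)
          exact pow_le_pow_left₀ (Finset.sum_nonneg fun _ _ => abs_nonneg _) (hMrow i) 2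
      _ = 4 := by rw [← Finset.sum_mul, hp1]; norm_num
  obtain ⟨hQi, hQ⟩ := hu.integrable_quadForm_and_integral_abs_le hK hT (by positivity) hAw hAV
  set e : Fin n → (Fin n → ℝ) → ℝ := fun i y => ∑ j, M i j * u j y with he
  set m : ℝ := ∑ j, A j j * s j with hm
  have hquad : ∀ y, ∑ j, ∑ l, A j l * (u j y * u l y) = ∑ i, p i * e i y ^ 2 := by
    intro y
    simp only [hA, he, ← sum_sum_sum_mul_eq_sum_mul_sq, Finset.sum_mul]
    refine Finset.sum_congr rfl fun j _ => Finset.sum_congr rfl fun l _ =>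
      Finset.sum_congr rfl fun i _ => ?_
    ring
  have hmeq : m = ∑ i, p i * (s i + (∑ j ∈ nn i, s j) / (J : ℝ) ^ 2) := by
    simp only [hm, hA, Finset.sum_mul]
    rw [Finset.sum_comm]
    refine Finset.sum_congr rfl fun i _ => ?_
    rw [← hMsq i s, Finset.mul_sum]
    exact Finset.sum_congr rfl fun j _ => by ring
  change Integrable (fun y => ∑ j, ∑ l, A j l * (u j y * u l y) - m) P at hQi
  change ∫ y, |∑ j, ∑ l, A j l * (u j y * u l y) - m| ∂P ≤ _ at hQ
  simp only [hquad] at hQi hQ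
  have he2 : ∀ i, MemLp (e i) 2 P := fun i => hu.memLp_sum _ _
  have hesq : ∀ i, ∫ y, e i y ^ 2 ∂P ≤ K * 2 := by
    intro i
    refine (hu.integral_sum_sq_le _ _).trans (mul_le_mul_of_nonneg_left ?_ hK)
    refine le_trans (Finset.sum_le_sum fun j _ => ?_) (hMrow i)
    rw [← sq_abs]
    exact pow_le_of_le_one (abs_nonneg _) (hM1 i j) two_ne_zero
  have hnn : ∀ i, (nn i).Nonempty := fun i => Finset.card_pos.1 (by rw [hcard]; exact hJ)
  set b : Fin n → ℝ := fun i => v i - (∑ j ∈ nn i, v j) / J with hb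
  have hbβ : ∀ i, b i ^ 2 ≤ β ^ 2 := by
    intro i
    have h := abs_sum_div_card_sub_le (hnn i) (hv i)
    rw [hcard] at h
    rw [← sq_abs]
    exact pow_le_pow_left₀ (abs_nonneg _) h 2
  obtain ⟨hRi, hR⟩ := integrable_and_integral_abs_sum_add_sq_sub_le hp hp1 he2
    (g := fun i _ => b i) (fun i => memLp_const _) (B := β ^ 2) hesq
    (fun i => by simpa using hbβ i) hQi hθ
  have hres : ∀ y, ∑ i, p i * nnResidualSq J nn y i - ∑ i, p i * s i =
      κ * (∑ i, p i * (e i y + b i) ^ 2 - m) + (κ * m - ∑ i, p i * s i) := by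
    intro y
    have : ∀ i, p i * nnResidualSq J nn y i = κ * (p i * (e i y + b i) ^ 2) := fun i => by
      rw [nnResidualSq_eq nn y v i]
      ring
    simp only [this, ← Finset.mul_sum]
    ring
  have hbias : |κ * m - ∑ i, p i * s i| ≤ β := by
    have hterm : ∀ i, |κ * (s i + (∑ j ∈ nn i, s j) / (J : ℝ) ^ 2) - s i| ≤ β := by
      intro i
      have h := abs_sum_div_card_sub_le (hnn i) (hσ i)
      rw [hcard] at h
      have e1 : κ * (s i + (∑ j ∈ nn i, s j) / (J : ℝ) ^ 2) - s i =
          -((s i - (∑ j ∈ nn i, s j) / (J : ℝ)) / (J + 1)) := by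
        rw [hκ]; field_simp; ring
      rw [e1, abs_neg, abs_div, abs_of_pos (by positivity : (0 : ℝ) < J + 1)]
      exact (div_le_self (abs_nonneg _) (by linarith)).trans h
    rw [hmeq, Finset.mul_sum, ← Finset.sum_sub_distrib]
    calc _ ≤ ∑ i, p i * β := by
          refine (Finset.abs_sum_le_sum_abs _ _).trans (Finset.sum_le_sum fun i _ => ?_)
          have e1 : κ * (p i * (s i + (∑ j ∈ nn i, s j) / (J : ℝ) ^ 2)) - p i * s i =
              p i * (κ * (s i + (∑ j ∈ nn i, s j) / (J : ℝ) ^ 2) - s i) := by ring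
          rw [e1, abs_mul, abs_of_nonneg (hp i)]
          exact mul_le_mul_of_nonneg_left (hterm i) (hp i)
      _ = β := by rw [← Finset.sum_mul, hp1, one_mul]
  change Integrable (fun y => ∑ i, p i * nnResidualSq J nn y i - ∑ i, p i * s i) P ∧
    ∫ y, |∑ i, p i * nnResidualSq J nn y i - ∑ i, p i * s i| ∂P ≤ _
  simp only [hres]
  refine ⟨(hRi.const_mul κ).add (integrable_const _), ?_⟩
  have hfin : ∫ y, |κ * (∑ i, p i * (e i y + b i) ^ 2 - m) + (κ * m - ∑ i, p i * s i)| ∂P ≤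
      ∫ y, (|∑ i, p i * (e i y + b i) ^ 2 - m| + β) ∂P := by
    refine integral_mono ((hRi.const_mul κ).add (integrable_const _)).abs
      (hRi.abs.add (integrable_const _)) fun y => ?_
    refine (abs_add_le _ _).trans (add_le_add ?_ hbias)
    rw [abs_mul, abs_of_nonneg hκ0]
    exact mul_le_of_le_one_left (abs_nonneg _) hκ1
  rw [integral_add hRi.abs (integrable_const _)] at hfin
  simp only [integral_const, probReal_univ, one_smul] at hfin
  linarith

/-- The `L¹` error of the weighted Nadaraya-Watson variance estimates, when all windows contain at
least `M` units, and the regression function varies by at most `β` within windows. -/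
theorem CenteredErrors.nwResidualSq_error_le {E : Type*} [NormedAddCommGroup E] {n : ℕ}
    {P : Measure (Fin n → ℝ)} [IsProbabilityMeasure P] [Nonempty (Fin n)]
    {K : ℝ} {τ : ℝ → ℝ} (hK : 0 ≤ K) {v : Fin n → ℝ}
    (hu : CenteredErrors P K τ fun i y => y i - v i) {x : Fin n → E} {d : Fin n → Bool} {h : ℝ}
    {M : ℕ} (hM0 : 0 < M) (hM : ∀ i, M ≤ (armBall x d h i).card)
    {β : ℝ} (hv : ∀ i, ∀ j ∈ armBall x d h i, |v j - v i| ≤ β)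
    {p : Fin n → ℝ} (hp : ∀ i, 0 ≤ p i) (hp1 : ∑ i, p i = 1) {w : ℝ} (hw : ∀ i, p i ≤ w)
    {T θ : ℝ} (hT : 0 < T) (hθ : 0 < θ) :
    Integrable (fun y => ∑ i, p i * nwResidualSq x d h y i -
      ∑ i, p i * ∫ y', (y' i - v i) ^ 2 ∂P) P ∧
    ∫ y, |∑ i, p i * nwResidualSq x d h y i - ∑ i, p i * ∫ y', (y' i - v i) ^ 2 ∂P| ∂P ≤
      (2 * 1 * τ T + T ^ 2 * √(w * 1)) +
        (θ * K + (1 + 1 / θ) * (2 * (K / M) + 2 * β ^ 2)) := by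
  set s : Fin n → ℝ := fun i => ∫ y, (y i - v i) ^ 2 ∂P with hs
  set N : Fin n → Finset (Fin n) := fun i => armBall x d h i with hN
  have hNc : ∀ i, (0 : ℝ) < (N i).card := fun i => by exact_mod_cast hM0.trans_le (hM i)
  obtain ⟨hDi, hD⟩ := hu.integrable_diag_and_integral_abs_le hT (c := p) (w := w) (V := 1)
    (fun i => by rw [abs_of_nonneg (hp i)]; exact hw i)
    (le_of_eq (by simp only [abs_of_nonneg (hp _), hp1]))
  have hrew : ∀ y : Fin n → ℝ, ∑ i, p i * ((y i - v i) ^ 2 - ∫ y', (y' i - v i) ^ 2 ∂P) =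
      ∑ i, p i * (y i - v i) ^ 2 - ∑ i, p i * s i := fun y => by
    simp only [mul_sub, Finset.sum_sub_distrib, hs]
  simp only [hrew] at hDi hD
  set g : Fin n → (Fin n → ℝ) → ℝ := fun i y =>
    -(∑ j ∈ N i, ((N i).card : ℝ)⁻¹ * (y j - v j)) + (v i - (∑ j ∈ N i, v j) / (N i).card) with hg
  have hA2 : ∀ i, MemLp (fun y : Fin n → ℝ => ∑ j ∈ N i, ((N i).card : ℝ)⁻¹ * (y j - v j)) 2 P :=
    fun i => hu.memLp_sum (N i) fun _ => ((N i).card : ℝ)⁻¹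
  have hg2 : ∀ i, MemLp (g i) 2 P := fun i => (hA2 i).neg.add (memLp_const _)
  have hgsq : ∀ i, ∫ y, g i y ^ 2 ∂P ≤ 2 * (K / M) + 2 * β ^ 2 := by
    intro i
    have h1 : ∫ y, g i y ^ 2 ∂P ≤
        ∫ y, (2 * (∑ j ∈ N i, ((N i).card : ℝ)⁻¹ * (y j - v j)) ^ 2 + 2 * β ^ 2) ∂P := by
      refine integral_mono (hg2 i).integrable_sq
        (((hA2 i).integrable_sq.const_mul 2).add (integrable_const _)) fun y => ?_
      have h2 := abs_sum_div_card_sub_le (Finset.card_pos.1 (hM0.trans_le (hM i))) (hv i)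
      have h3 := pow_le_pow_left₀ (abs_nonneg _) h2 2
      rw [sq_abs] at h3
      simp only [hg]
      have := sq_nonneg ((∑ j ∈ N i, ((N i).card : ℝ)⁻¹ * (y j - v j)) +
        (v i - (∑ j ∈ N i, v j) / (N i).card))
      nlinarith
    rw [integral_add ((hA2 i).integrable_sq.const_mul 2) (integrable_const _),
      integral_const_mul] at h1
    simp only [integral_const, probReal_univ, one_smul] at h1
    have h4 := hu.integral_sum_sq_le (N i) fun _ => ((N i).card : ℝ)⁻¹
    have h5 : K * ∑ j ∈ N i, ((N i).card : ℝ)⁻¹ ^ 2 ≤ K / M := by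
      rw [Finset.sum_const, nsmul_eq_mul, div_eq_mul_inv]
      refine mul_le_mul_of_nonneg_left ?_ hK
      have e1 : ((N i).card : ℝ) * ((N i).card : ℝ)⁻¹ ^ 2 = ((N i).card : ℝ)⁻¹ := by
        have := (hNc i).ne'
        field_simp
      rw [e1]
      exact inv_anti₀ (by exact_mod_cast hM0) (by exact_mod_cast hM i)
    linarith
  obtain ⟨hRi, hR⟩ := integrable_and_integral_abs_sum_add_sq_sub_le hp hp1 hu.memLp hg2
    hu.sq_le hgsq hDi hθ
  have hres : ∀ y i, nwResidualSq x d h y i = ((y i - v i) + g i y) ^ 2 := by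
    intro y i
    have := (hNc i).ne'
    rw [nwResidualSq]
    congr 1
    simp only [hg, ← Finset.mul_sum, Finset.sum_sub_distrib]
    change y i - (∑ j ∈ N i, y j) / (N i).card = _
    field_simp
    ring
  simp only [hres]
  exact ⟨hRi, hR.trans (by linarith)⟩

/-! ### Asymptotic coverage -/

theorem exists_pos_lt_of_continuousAt {φ : ℝ → ℝ} (hφ : ContinuousAt φ 0) (h0 : φ 0 = 0) {ε : ℝ}
    (hε : 0 < ε) : ∃ z : ℝ, 0 < z ∧ φ z < ε := by
  have h : Tendsto φ (𝓝[>] 0) (𝓝 (φ 0)) := hφ.tendsto.mono_left nhdsWithin_le_nhds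
  rw [h0] at h
  obtain ⟨z, hz, hz0⟩ := ((h.eventually (gt_mem_nhds hε)).and self_mem_nhdsWithin).exists
  exact ⟨z, hz0, hz⟩

theorem exists_pos_mul_rpow_neg_lt {K : ℝ} (hK : 0 < K) (A : ℝ) {ε : ℝ} (hε : 0 < ε) :
    ∃ T : ℝ, 0 < T ∧ A * (T ^ (-(1 / K)) * K) < ε := by
  have h := (tendsto_rpow_neg_mul_atTop hK).const_mul A
  rw [mul_zero] at h
  obtain ⟨T, hT, hT0⟩ := ((h.eventually (gt_mem_nhds hε)).and (eventually_gt_atTop 0)).exists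
  exact ⟨T, hT0, hT⟩

/-- Every unit has asymptotically negligible influence on the linear estimator with weights `k n`.
-/
def NegligibleWeights (k : (n : ℕ) → Fin n → ℝ) : Prop :=
  ∀ w : ℝ, 0 < w → ∀ᶠ n in atTop, 0 < ∑ j, k n j ^ 2 ∧ ∀ i, k n i ^ 2 ≤ w * ∑ j, k n j ^ 2

/-- The variance estimates `usq`, averaged with the relative squared weights of the estimator,
converge in `L¹` to the average variance, uniformly over the Lipschitz class. -/
def WeightedVarianceConsistent {E : Type*} [NormedAddCommGroup E] (C : ℕ → ℝ)
    (x : (n : ℕ) → Fin n → E) (d : (n : ℕ) → Fin n → Bool) (σsq : E → Bool → ℝ)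
    (P : (n : ℕ) → (E → Bool → ℝ) → Measure (Fin n → ℝ)) (k : (n : ℕ) → Fin n → ℝ)
    (usq : (n : ℕ) → (Fin n → ℝ) → Fin n → ℝ) : Prop :=
  ∀ ε : ℝ, 0 < ε → ∀ᶠ n in atTop, ∀ f ∈ FLip E (C n),
    Integrable (fun y => ∑ i, k n i ^ 2 / (∑ j, k n j ^ 2) * usq n y i -
      ∑ i, k n i ^ 2 / (∑ j, k n j ^ 2) * σsq (x n i) (d n i)) (P n f) ∧
    ∫ y, |∑ i, k n i ^ 2 / (∑ j, k n j ^ 2) * usq n y i -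
      ∑ i, k n i ^ 2 / (∑ j, k n j ^ 2) * σsq (x n i) (d n i)| ∂(P n f) ≤ ε

section Model

variable {E : Type*} [NormedAddCommGroup E] {K : ℝ} {C : ℕ → ℝ} {x : (n : ℕ) → Fin n → E}
  {d : (n : ℕ) → Fin n → Bool} {σsq : E → Bool → ℝ}
  {P : (n : ℕ) → (E → Bool → ℝ) → Measure (Fin n → ℝ)} {k : (n : ℕ) → Fin n → ℝ}

theorem weightedVarianceConsistent_nw (hK : 0 < K) (hC : ∀ n, 0 < C n)
    (hP : ∀ n, ∀ f ∈ FLip E (C n), FixedDesignModel K σsq (x n) (d n) f (P n f))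
    (hk : NegligibleWeights k) {h : ℕ → ℝ} (hh : Tendsto (fun n => h n * C n) atTop (𝓝 0))
    (hball : ArmBallsGrow x d h) :
    WeightedVarianceConsistent C x d σsq P k fun n y => nwResidualSq (x n) (d n) (h n) y := by
  intro ε hε
  have hε' : 0 < ε / 5 := by linarith
  obtain ⟨θ, hθ0, hθ⟩ := exists_pos_lt_of_continuousAt (φ := fun θ => θ * K) (by fun_prop)
    (by simp) hε'
  obtain ⟨β, hβ0, hβ⟩ := exists_pos_lt_of_continuousAt
    (φ := fun β => (1 + 1 / θ) * (2 * β ^ 2)) (by fun_prop) (by simp) hε'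
  obtain ⟨q, hq0, hq⟩ := exists_pos_lt_of_continuousAt
    (φ := fun q => (1 + 1 / θ) * (2 * (K * q))) (by fun_prop) (by simp) hε'
  obtain ⟨T, hT0, hT⟩ := exists_pos_mul_rpow_neg_lt hK (2 * 1) hε'
  obtain ⟨w, hw0, hw⟩ := exists_pos_lt_of_continuousAt
    (φ := fun w => T ^ 2 * √(w * 1)) (by fun_prop) (by simp) hε'
  obtain ⟨M, hM⟩ := exists_nat_gt q⁻¹
  have hM0 : (0 : ℝ) < M := (inv_pos.2 hq0).trans hM
  filter_upwards [hk w hw0, hball M, hh.eventually (gt_mem_nhds hβ0), eventually_gt_atTop 0]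
    with n hkn hbn hhn hn f hf
  have hmod := hP n f hf
  have := hmod.isProbabilityMeasure
  have : Nonempty (Fin n) := ⟨⟨0, hn⟩⟩
  have hv : ∀ i, ∀ j ∈ armBall (x n) (d n) (h n) i,
      |f (x n j) (d n j) - f (x n i) (d n i)| ≤ β := by
    intro i j hj
    simp only [armBall, Finset.mem_filter, Finset.mem_univ, true_and] at hj
    rw [hj.2]
    refine (hf _ _ _).trans ?_
    have := mul_le_mul_of_nonneg_left hj.1 (hC n).le
    linarith
  have := (hmod.centeredErrors hK).nwResidualSq_error_le hK.le
    (v := fun i => f (x n i) (d n i)) (by exact_mod_cast hM0) hbn hv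
    (p := fun i => k n i ^ 2 / ∑ j, k n j ^ 2) (fun i => div_nonneg (sq_nonneg _) hkn.1.le)
    (by rw [← Finset.sum_div, div_self hkn.1.ne'])
    (fun i => (div_le_iff₀ hkn.1).2 (hkn.2 i)) hT0 hθ0
  simp only [hmod.variance] at this
  refine ⟨this.1, this.2.trans ?_⟩
  have hMq : (1 + 1 / θ) * (2 * (K / M)) ≤ (1 + 1 / θ) * (2 * (K * q)) := by
    have : K / M ≤ K * q := by
      rw [div_eq_mul_inv]
      exact mul_le_mul_of_nonneg_left (inv_le_of_inv_le₀ hq0 hM.le) hK.le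
    gcongr
  linarith

theorem weightedVarianceConsistent_nn [NormedSpace ℝ E] [FiniteDimensional ℝ E] (hK : 0 < K)
    {c : ℝ} (hc : 0 < c) (hC : ∀ n, c ≤ C n)
    (hdens : ∀ η : ℝ, 0 < η → ArmBallsGrow x d (fun n => η / C n))
    (hσ : ∀ t : Bool, UniformContinuous (fun z : E => σsq z t))
    (hP : ∀ n, ∀ f ∈ FLip E (C n), FixedDesignModel K σsq (x n) (d n) f (P n f))
    (hk : NegligibleWeights k) {J : ℕ} {N : Seminorm ℝ E} {nn : (n : ℕ) → Fin n → Finset (Fin n)}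
    (hJ : 1 ≤ J) (hN : ∀ z, N z = 0 → z = 0)
    (hnn : ∀ᶠ n in atTop, ∀ i, IsNearestNeighbors N (x n) (d n) J i (nn n i))
    (hdup : DuplicateUseBounded x nn) :
    WeightedVarianceConsistent C x d σsq P k fun n y => nnResidualSq J (nn n) y := by
  classical
  intro ε hε
  obtain ⟨M, hM⟩ := hdup
  obtain ⟨G, hG⟩ := exists_card_neighborOf_le N hN J
  obtain ⟨a, b, ha, hb, hab⟩ := N.exists_equiv_norm hN
  have hε' : 0 < ε / 4 := by linarith
  obtain ⟨θ, hθ0, hθ⟩ := exists_pos_lt_of_continuousAt (φ := fun θ => θ * (K * 2)) (by fun_prop)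
    (by simp) hε'
  obtain ⟨β, hβ0, hβ⟩ := exists_pos_lt_of_continuousAt
    (φ := fun β => (1 + 1 / θ) * β ^ 2 + β) (by fun_prop) (by simp) hε'
  obtain ⟨T, hT0, hT⟩ := exists_pos_mul_rpow_neg_lt hK (2 * 4) hε'
  obtain ⟨w, hw0, hw⟩ := exists_pos_lt_of_continuousAt
    (φ := fun w => T ^ 2 * √((1 + (G + M : ℕ)) * w * 4) +
      √(2 * K ^ 2 * ((1 + (G + M : ℕ)) * w * 4))) (by fun_prop) (by simp) hε'
  -- a radius within which regression and variance functions vary by at most `β`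
  obtain ⟨ρ, hρ0, hρ⟩ : ∃ ρ > 0, ∀ (t : Bool) (z z' : E), ‖z - z'‖ < ρ →
      |σsq z t - σsq z' t| ≤ β := by
    obtain ⟨ρ₁, h1, h1'⟩ := Metric.uniformContinuous_iff.1 (hσ true) β hβ0
    obtain ⟨ρ₀, h0, h0'⟩ := Metric.uniformContinuous_iff.1 (hσ false) β hβ0
    refine ⟨min ρ₁ ρ₀, lt_min h1 h0, fun t z z' hz => ?_⟩
    rw [← Real.dist_eq]
    rw [← dist_eq_norm] at hz
    cases t
    · exact (h0' (hz.trans_le (min_le_right _ _))).le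
    · exact (h1' (hz.trans_le (min_le_left _ _))).le
  set η : ℝ := min β (c * ρ / 2) / (b / a) with hη
  have hba : 0 < b / a := div_pos hb ha
  have hη0 : 0 < η := by positivity
  have hηba : b / a * η = min β (c * ρ / 2) := by rw [hη]; field_simp
  filter_upwards [hk w hw0, hdens η hη0 (J + 1), hnn, eventually_gt_atTop 0]
    with n hkn hbn hnnn hn f hf
  have hCn : 0 < C n := hc.trans_le (hC n)
  have hmod := hP n f hf
  have := hmod.isProbabilityMeasure
  have : Nonempty (Fin n) := ⟨⟨0, hn⟩⟩
  have hnear : ∀ i, ∀ j ∈ nn n i, ‖x n j - x n i‖ ≤ min β (c * ρ / 2) / C n := by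
    intro i j hj
    have := (hnnn i).norm_sub_le ha hb hab (by positivity) (hbn i) hj
    rwa [← mul_div_assoc, hηba] at this
  have hv : ∀ i, ∀ j ∈ nn n i, |f (x n j) (d n j) - f (x n i) (d n i)| ≤ β := by
    intro i j hj
    rw [((hnnn i).2.1 j hj).2]
    refine (hf _ _ _).trans ?_
    have h1 := mul_le_mul_of_nonneg_left (hnear i j hj) hCn.le
    rw [mul_div_cancel₀ _ hCn.ne'] at h1
    exact h1.trans (min_le_left _ _)
  have hs : ∀ i, ∀ j ∈ nn n i, |σsq (x n j) (d n j) - σsq (x n i) (d n i)| ≤ β := by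
    intro i j hj
    rw [((hnnn i).2.1 j hj).2]
    refine hρ _ _ _ ((hnear i j hj).trans_lt ?_)
    rw [div_lt_iff₀ hCn]
    -- here the Lipschitz constants must stay away from zero
    have h1 : ρ * c ≤ ρ * C n := mul_le_mul_of_nonneg_left (hC n) hρ0.le
    have h2 := min_le_right β (c * ρ / 2)
    have h3 : 0 < c * ρ := by positivity
    linarith
  have huse : ∀ j, (Finset.univ.filter fun i : Fin n => j ∈ nn n i).card ≤ G + M := by
    intro j
    have h1 := hG n (x n) (d n) (nn n) hnnn j
    have h2 := hM n j
    have h3 : (Finset.univ.filter fun i : Fin n => j ∈ nn n i) ⊆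
        (Finset.univ.filter fun i : Fin n => x n i ≠ x n j ∧ j ∈ nn n i) ∪
          (Finset.univ.filter fun i : Fin n => x n i = x n j ∧ j ∈ nn n i) := by
      intro i hi
      simp only [Finset.mem_union, Finset.mem_filter, Finset.mem_univ, true_and] at *
      tauto
    refine (Finset.card_le_card h3).trans ((Finset.card_union_le _ _).trans (add_le_add ?_ ?_))
    · convert h1
    · convert h2
  have hfin := (hmod.centeredErrors hK).nnResidualSq_error_le hK.le
    (v := fun i => f (x n i) (d n i)) hJ (fun i => (hnnn i).1)
    (fun i hi => ((hnnn i).2.1 i hi).1 rfl) (fun j => by convert huse j) hv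
    (fun i j hj => by rw [hmod.variance, hmod.variance]; exact hs i j hj)
    (p := fun i => k n i ^ 2 / ∑ j, k n j ^ 2) (fun i => div_nonneg (sq_nonneg _) hkn.1.le)
    (by rw [← Finset.sum_div, div_self hkn.1.ne'])
    (fun i => (div_le_iff₀ hkn.1).2 (hkn.2 i)) hT0 hθ0
  simp only [hmod.variance] at hfin
  refine ⟨hfin.1, hfin.2.trans ?_⟩
  linarith

/-- The standard deviation of the linear estimator with weights `k`. -/
noncomputable def estimatorSD {n : ℕ} (σsq : E → Bool → ℝ) (x : Fin n → E) (d : Fin n → Bool)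
    (k : Fin n → ℝ) : ℝ := √(∑ i, k i ^ 2 * σsq (x i) (d i))

omit [NormedAddCommGroup E] in
theorem sum_sq_div_le_sum_mul {n : ℕ} {x : Fin n → E} {d : Fin n → Bool} {f : E → Bool → ℝ}
    {P : Measure (Fin n → ℝ)} (h : FixedDesignModel K σsq x d f P) (k : Fin n → ℝ) :
    (∑ i, k i ^ 2) / K ≤ ∑ i, k i ^ 2 * σsq (x i) (d i) := by
  rw [Finset.sum_div]
  refine Finset.sum_le_sum fun i _ => ?_
  have := h.variance_lower i
  rw [h.variance] at this
  rw [div_eq_mul_one_div]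
  exact mul_le_mul_of_nonneg_left this (sq_nonneg _)

/-- Central limit theorem for the linear estimator, uniformly over the Lipschitz class and over all
intervals. -/
theorem eventually_gaussianReal_Icc_le_noise (hK : 0 < K) (hC : ∀ n, 0 ≤ C n)
    (hP : ∀ n, ∀ f ∈ FLip E (C n), FixedDesignModel K σsq (x n) (d n) f (P n f))
    (hk : NegligibleWeights k) {ε : ℝ} (hε : 0 < ε) :
    ∀ᶠ n in atTop, ∀ f ∈ FLip E (C n), ∀ a b : ℝ,
      (gaussianReal 0 1).real (Set.Icc a b) ≤
        (P n f).real {y | ∑ i, k n i / estimatorSD σsq (x n) (d n) (k n) *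
          (y i - f (x n i) (d n i)) ∈ Set.Icc a b} + ε := by
  set S : (n : ℕ) → (E → Bool → ℝ) → (Fin n → ℝ) → ℝ := fun n f y =>
    ∑ i, k n i / estimatorSD σsq (x n) (d n) (k n) * (y i - f (x n i) (d n i)) with hS
  have hSm : ∀ n f, Measurable (S n f) := fun n f => by fun_prop
  -- it suffices to consider the worst regression function at each sample size
  have hworst : ∀ n, ∃ f ∈ FLip E (C n),
      (∀ a b : ℝ, (gaussianReal 0 1).real (Set.Icc a b) ≤
        (P n f).real {y | S n f y ∈ Set.Icc a b} + ε) → ∀ g ∈ FLip E (C n), ∀ a b : ℝ,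
        (gaussianReal 0 1).real (Set.Icc a b) ≤
          (P n g).real {y | S n g y ∈ Set.Icc a b} + ε := by
    intro n
    by_cases h : ∀ g ∈ FLip E (C n), ∀ a b : ℝ, (gaussianReal 0 1).real (Set.Icc a b) ≤
        (P n g).real {y | S n g y ∈ Set.Icc a b} + ε
    · exact ⟨fun _ _ => 0, fun _ z z' => by
        simpa using mul_nonneg (hC n) (norm_nonneg (z - z')), fun _ => h⟩
    · push Not at h
      obtain ⟨g, hg, a, b, hab⟩ := h
      exact ⟨g, hg, fun h' => absurd (h' a b) (not_le.2 hab)⟩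
  choose f hf hfworst using hworst
  have hprob : ∀ n, IsProbabilityMeasure (P n (f n)) := fun n => (hP n _ (hf n)).isProbabilityMeasure
  have hprob' : ∀ n, IsProbabilityMeasure ((P n (f n)).map (S n (f n))) := fun n =>
    Measure.isProbabilityMeasure_map (hSm n _).aemeasurable
  have hchar : ∀ t : ℝ, Tendsto (fun n => charFun ((P n (f n)).map (S n (f n))) t) atTop
      (𝓝 (Complex.exp (-t ^ 2 / 2))) := by
    intro t
    rw [tendsto_iff_norm_sub_tendsto_zero]
    refine tendsto_order.2 ⟨fun c hc => Eventually.of_forall fun n => hc.trans_le (norm_nonneg _),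
      fun e he => ?_⟩
    obtain ⟨T, hT0, hT⟩ := exists_pos_mul_rpow_neg_lt hK (4 * t ^ 2 * K) (half_pos he)
    obtain ⟨ρ, hρ0, hρ⟩ := exists_pos_lt_of_continuousAt
      (φ := fun ρ => (4 * t ^ 2 * (ρ * |t| * T * K) + t ^ 4 * ρ ^ 2 * K ^ 2) * K) (by fun_prop)
      (by simp) (half_pos he)
    filter_upwards [hk (ρ ^ 2 / K) (by positivity)] with n hkn
    have hmod := hP n _ (hf n)
    have hlow := sum_sq_div_le_sum_mul hmod (k n)
    set v := ∑ i, k n i ^ 2 * σsq (x n i) (d n i) with hv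
    have hv0 : 0 < v := (div_pos hkn.1 hK).trans_le hlow
    have hsd : estimatorSD σsq (x n) (d n) (k n) ^ 2 = v := Real.sq_sqrt hv0.le
    have hKv : ∑ j, k n j ^ 2 ≤ K * v := by rwa [div_le_iff₀ hK, mul_comm] at hlow
    have hbound := (hmod.centeredErrors hK).norm_charFun_sum_sub_le hK.le
      (a := fun i => k n i / estimatorSD σsq (x n) (d n) (k n)) (ρ := ρ) (V := K)
      (fun i => by
        refine abs_le_of_sq_le_sq ?_ hρ0.le
        rw [div_pow, hsd, div_le_iff₀ hv0]
        calc k n i ^ 2 ≤ ρ ^ 2 / K * ∑ j, k n j ^ 2 := hkn.2 i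
          _ ≤ ρ ^ 2 / K * (K * v) := by gcongr
          _ = ρ ^ 2 * v := by field_simp)
      (by
        simp only [div_pow, hsd]
        rw [← Finset.sum_div, div_le_iff₀ hv0]
        exact hKv)
      (by
        simp only [div_pow, hsd, hmod.variance, div_mul_eq_mul_div]
        rw [← Finset.sum_div, ← hv, div_self hv0.ne'])
      t hT0
    refine lt_of_le_of_lt hbound ?_
    linarith
  filter_upwards [eventually_gaussianReal_Icc_le hchar hε] with n hn
  refine hfworst n fun a b => ?_
  have := hn a b
  rwa [map_measureReal_apply (hSm n _) measurableSet_Icc] at this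

theorem mem_feasibleFLCI_of_abs_le {n : ℕ} {α c₀ Cn s r : ℝ} {x : Fin n → E} {d : Fin n → Bool}
    {k usq y : Fin n → ℝ} {L : ℝ} (hs : 0 < s) (hse : robustSE k usq = r * s)
    (hc : c₀ ≤ cv α (maxBias Cn x d k / s / r) * r) (hL : |linearEstimator k y - L| ≤ c₀ * s) :
    L ∈ feasibleFLCI α Cn x d k usq y := by
  have e : maxBias Cn x d k / (r * s) = maxBias Cn x d k / s / r := by rw [div_div, mul_comm]
  have h1 : c₀ * s ≤ cv α (maxBias Cn x d k / s / r) * (r * s) := by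
    rw [← mul_assoc]
    exact mul_le_mul_of_nonneg_right hc hs.le
  rw [feasibleFLCI, hse, e]
  rw [abs_le] at hL
  constructor <;> linarith

/-- Coverage of the interval: on the event that the relative error of the standard error is small,
the half-length is at least the critical value of a slightly smaller level, and the normal
approximation of the noise and the bound on the bias apply. -/
theorem hasAsymptoticCoverage_feasibleFLCI {α : ℝ} (hα0 : 0 < α) (hα1 : α < 1) (hK : 0 < K)
    (hC : ∀ n, 0 ≤ C n)
    (hP : ∀ n, ∀ f ∈ FLip E (C n), FixedDesignModel K σsq (x n) (d n) f (P n f))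
    (hk : NegligibleWeights k) (hcon : ∀ᶠ n in atTop, IsContrast (d n) (k n))
    {usq : (n : ℕ) → (Fin n → ℝ) → Fin n → ℝ}
    (husq : WeightedVarianceConsistent C x d σsq P k usq) :
    HasAsymptoticCoverage α C x P
      (fun n y => feasibleFLCI α (C n) (x n) (d n) (k n) (usq n y) y) := by
  have key : ∀ τ : ℝ, 0 < τ → α + τ < 1 → ∀ᶠ n in atTop, ∀ f ∈ FLip E (C n),
      1 - α - 3 * τ ≤ (P n f).real {y | cate (x n) f ∈
        feasibleFLCI α (C n) (x n) (d n) (k n) (usq n y) y} := by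
    intro τ hτ hτ1
    obtain ⟨η, hη0, hη1, hη⟩ := exists_cv_le_mul_cv hα0 hτ hτ1
    filter_upwards [hk 1 one_pos, hcon, eventually_gaussianReal_Icc_le_noise hK hC hP hk hτ,
      husq (τ * (η / K)) (by positivity)] with n hkn hcn hclt hvar f hf
    have hmod := hP n f hf
    have := hmod.isProbabilityMeasure
    have hlow := sum_sq_div_le_sum_mul hmod (k n)
    obtain ⟨hDi, hD⟩ := hvar f hf
    set Q := ∑ j, k n j ^ 2 with hQ
    set v := ∑ i, k n i ^ 2 * σsq (x n i) (d n i) with hv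
    set s := estimatorSD σsq (x n) (d n) (k n) with hs
    set D : (Fin n → ℝ) → ℝ := fun y => ∑ i, k n i ^ 2 / Q * usq n y i -
      ∑ i, k n i ^ 2 / Q * σsq (x n i) (d n i) with hDdef
    have hQ0 : 0 < Q := hkn.1
    have hv0 : 0 < v := (div_pos hQ0 hK).trans_le hlow
    have hs0 : 0 < s := Real.sqrt_pos.2 hv0
    have hs2 : s ^ 2 = v := Real.sq_sqrt hv0.le
    set b := (∑ i, k n i * f (x n i) (d n i) - cate (x n) f) / s with hb
    set B := maxBias (C n) (x n) (d n) (k n) / s with hB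
    set c₀ := cv (α + τ) B with hc₀
    have hbB : |b| ≤ B := by
      rw [hb, abs_div, abs_of_pos hs0]
      exact div_le_div_of_nonneg_right (hcn.abs_bias_le_maxBias hf) hs0.le
    set S : (Fin n → ℝ) → ℝ := fun y => ∑ i, k n i / s * (y i - f (x n i) (d n i)) with hS
    have hprob : 1 - (α + τ) ≤ (P n f).real {y | S y ∈ Set.Icc (-c₀ - b) (c₀ - b)} + τ := by
      refine le_trans ?_ (hclt f hf _ _)
      rw [← foldedNormalCDF_eq_Icc]
      exact (le_foldedNormalCDF_cv (by linarith) B).trans (foldedNormalCDF_antitone hbB c₀)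
    have hmarkov : (P n f).real {y | η / K ≤ |D y|} ≤ τ := by
      have h1 := mul_meas_ge_le_integral_of_nonneg (μ := P n f) (f := fun y => |D y|)
        (ae_of_all _ fun y => abs_nonneg _) hDi.abs (η / K)
      have h2 := h1.trans hD
      rw [mul_comm] at h2
      exact le_of_mul_le_mul_right h2 (by positivity)
    have hsub : {y | S y ∈ Set.Icc (-c₀ - b) (c₀ - b)} ⊆
        {y | cate (x n) f ∈ feasibleFLCI α (C n) (x n) (d n) (k n) (usq n y) y} ∪
          {y | η / K ≤ |D y|} := by
      intro y hy
      by_cases hyD : η / K ≤ |D y|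
      · exact Or.inr hyD
      left
      push Not at hyD
      -- the relative error of the squared standard error
      have hse2 : ∑ i, k n i ^ 2 * usq n y i = (1 + Q * D y / v) * s ^ 2 := by
        have e1 : ∀ z : ℝ, ∀ i, Q * (k n i ^ 2 / Q * z) = k n i ^ 2 * z := fun z i => by
          field_simp
        have e2 : Q * D y = ∑ i, k n i ^ 2 * usq n y i - v := by
          simp only [hDdef, mul_sub, Finset.mul_sum, e1, hv]
        rw [hs2, e2]
        field_simp
        ring
      have hrel : |Q * D y / v| ≤ η := by
        rw [abs_div, abs_mul, abs_of_pos hQ0, abs_of_pos hv0, div_le_iff₀ hv0]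
        rw [div_le_iff₀ hK] at hlow
        calc Q * |D y| ≤ (v * K) * (η / K) := by gcongr
          _ = η * v := by field_simp
      have hpos : 0 < 1 + Q * D y / v := by
        have := (abs_le.1 hrel).1
        linarith
      set r := √(1 + Q * D y / v) with hr
      have hr2 : r ^ 2 = 1 + Q * D y / v := Real.sq_sqrt hpos.le
      have hr0 : 0 ≤ r := Real.sqrt_nonneg _
      have hr1 : |r - 1| ≤ η := by
        refine le_trans ?_ hrel
        have e1 : Q * D y / v = (r - 1) * (r + 1) := by linarith [hr2]
        rw [e1, abs_mul, abs_of_nonneg (by linarith : 0 ≤ r + 1)]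
        exact le_mul_of_one_le_right (abs_nonneg _) (by linarith)
      -- `r` is the ratio of the standard error to the standard deviation
      refine mem_feasibleFLCI_of_abs_le hs0 (r := r) ?_ (hη r B hr1) ?_
      · rw [robustSE, hse2, Real.sqrt_mul hpos.le, Real.sqrt_sq hs0.le]
      · have e1 : linearEstimator (k n) y - cate (x n) f = (S y + b) * s := by
          have e2 : S y * s = ∑ i, k n i * (y i - f (x n i) (d n i)) := by
            simp only [hS, Finset.sum_mul]
            refine Finset.sum_congr rfl fun i _ => ?_
            field_simp
          rw [add_mul, e2, hb, div_mul_cancel₀ _ hs0.ne', linearEstimator]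
          simp only [mul_sub, Finset.sum_sub_distrib]
          ring
        rw [e1, abs_mul, abs_of_pos hs0]
        refine mul_le_mul_of_nonneg_right ?_ hs0.le
        rw [abs_le]
        have hy1 : -c₀ - b ≤ S y := hy.1
        have hy2 : S y ≤ c₀ - b := hy.2
        constructor <;> linarith
    have h1 := measureReal_mono (μ := P n f) hsub
    have h2 := measureReal_union_le (μ := P n f)
      {y | cate (x n) f ∈ feasibleFLCI α (C n) (x n) (d n) (k n) (usq n y) y} {y | η / K ≤ |D y|}
    linarith
  rw [HasAsymptoticCoverage]
  have hlim : Tendsto (fun τ : ℝ => ENNReal.ofReal (1 - α - 3 * τ)) (𝓝[>] 0)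
      (𝓝 (ENNReal.ofReal (1 - α))) := by
    have : Continuous fun τ : ℝ => ENNReal.ofReal (1 - α - 3 * τ) :=
      ENNReal.continuous_ofReal.comp (by fun_prop)
    simpa using (this.tendsto 0).mono_left nhdsWithin_le_nhds
  refine le_of_tendsto hlim ?_
  have hsmall : ∀ᶠ τ : ℝ in 𝓝[>] 0, τ < 1 - α :=
    nhdsWithin_le_nhds (gt_mem_nhds (by linarith))
  filter_upwards [hsmall, self_mem_nhdsWithin] with τ hτ hτ0
  refine le_liminf_of_le (by isBoundedDefault) ?_
  filter_upwards [key τ hτ0 (by linarith)] with n hn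
  refine le_iInf₂ fun f hf => ?_
  have := (hP n f hf).isProbabilityMeasure
  exact (ENNReal.ofReal_le_iff_le_toReal (measure_ne_top _ _)).2 (hn f hf)

theorem armBall_mono {n : ℕ} (x : Fin n → E) (d : Fin n → Bool) {r r' : ℝ} (h : r ≤ r')
    (i : Fin n) : armBall x d r i ⊆ armBall x d r' i := by
  intro j hj
  simp only [armBall, Finset.mem_filter, Finset.mem_univ, true_and] at *
  exact ⟨hj.1.trans h, hj.2⟩

/-- A diagonal sequence: the radii `1 / (m + 1)` are used from the sample size on at which the balls
contain at least `m` units. -/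
theorem exists_slow_bandwidth (hC : ∀ n, 0 < C n)
    (hdens : ∀ η : ℝ, 0 < η → ArmBallsGrow x d (fun n => η / C n)) :
    ∃ ε : ℕ → ℝ, (∀ n, 0 < ε n) ∧ Tendsto ε atTop (𝓝 0) ∧
      ∀ h : ℕ → ℝ, (∀ᶠ n in atTop, ε n ≤ h n * C n) → ArmBallsGrow x d h := by
  have h1 : ∀ m : ℕ, ∃ n₀, ∀ n ≥ n₀, ∀ i : Fin n,
      m ≤ (armBall (x n) (d n) (1 / ((m : ℝ) + 1) / C n) i).card := fun m =>
    eventually_atTop.1 (hdens (1 / ((m : ℝ) + 1)) (by positivity) m)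
  choose n₀ hn₀ using h1
  set g : ℕ → ℕ := fun n => Nat.findGreatest (fun m => n₀ m ≤ n) n with hg
  have hgt : ∀ m, ∀ᶠ n in atTop, m ≤ g n := fun m => by
    filter_upwards [eventually_ge_atTop m, eventually_ge_atTop (n₀ m)] with n h2 h3
    exact Nat.le_findGreatest h2 h3
  have hgs : ∀ᶠ n in atTop, n₀ (g n) ≤ n := by
    filter_upwards [eventually_ge_atTop (n₀ 0)] with n h2
    exact Nat.findGreatest_spec (P := fun m => n₀ m ≤ n) (Nat.zero_le n) h2
  refine ⟨fun n => 1 / ((g n : ℝ) + 1), fun n => by positivity, ?_, fun h hh M => ?_⟩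
  · exact tendsto_one_div_add_atTop_nhds_zero_nat.comp (tendsto_atTop.2 hgt)
  · filter_upwards [hh, hgs, hgt M] with n h2 h3 h4 i
    refine h4.trans ((hn₀ (g n) n h3 i).trans (Finset.card_le_card (armBall_mono _ _ ?_ i)))
    rwa [div_le_iff₀ (hC n)]

end Model

theorem mainTheorem5 {E : Type*} [NormedAddCommGroup E] [NormedSpace ℝ E] [FiniteDimensional ℝ E]
    (α δ K : ℝ) (hα0 : 0 < α) (hα1 : α < 1) (hδ : 0 < δ) (hK : 0 < K)
    -- Lipschitz constants, bounded away from zero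
    (C : ℕ → ℝ) (hC : ∃ c : ℝ, 0 < c ∧ ∀ n, c ≤ C n)
    -- covariates and treatments, with both treatment arms nonempty in large samples
    (x : (n : ℕ) → Fin n → E) (d : (n : ℕ) → Fin n → Bool)
    (harms : ∀ᶠ n in atTop, (∃ i, d n i = true) ∧ (∃ i, d n i = false))
    (hdens : ∀ η : ℝ, 0 < η → ArmBallsGrow x d (fun n => η / C n))
    -- variance function and laws of the outcomes
    (σsq : E → Bool → ℝ) (hσ : ∀ t : Bool, UniformContinuous (fun z : E => σsq z t))
    (P : (n : ℕ) → (E → Bool → ℝ) → Measure (Fin n → ℝ))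
    (hP : ∀ n, ∀ f ∈ FLip E (C n), FixedDesignModel K σsq (x n) (d n) f (P n f))
    -- initial variance guess
    (σtsq : E → Bool → ℝ) (hσt : ∃ a b : ℝ, 0 < a ∧ ∀ z t, a ≤ σtsq z t ∧ σtsq z t ≤ b)
    -- solutions of the optimization problem that defines the weights
    (fs : ℕ → E → Bool → ℝ)
    (hfs : ∀ n, (∃ i, d n i = true) → (∃ i, d n i = false) →
      IsModulusSolution (C n) δ σtsq (x n) (d n) (fs n)) :
    -- nearest-neighbor variance estimates
    (∀ (J : ℕ) (N : Seminorm ℝ E) (nn : (n : ℕ) → Fin n → Finset (Fin n)),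
      1 ≤ J → (∀ z, N z = 0 → z = 0) →
      (∀ᶠ n in atTop, ∀ i, IsNearestNeighbors N (x n) (d n) J i (nn n i)) →
      DuplicateUseBounded x nn →
      HasAsymptoticCoverage α C x P (fun n y =>
        feasibleFLCI α (C n) (x n) (d n) (optimalWeight σtsq (x n) (d n) (fs n))
          (nnResidualSq J (nn n) y) y)) ∧
    -- uniform-kernel variance estimates
    (∀ h : ℕ → ℝ, Tendsto (fun n => h n * C n) atTop (𝓝 0) → ArmBallsGrow x d h →
      HasAsymptoticCoverage α C x P (fun n y =>
        feasibleFLCI α (C n) (x n) (d n) (optimalWeight σtsq (x n) (d n) (fs n))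
          (nwResidualSq (x n) (d n) (h n) y) y)) ∧
    -- the bandwidth condition holds whenever `h n * C n` tends to zero slowly enough
    (∃ ε : ℕ → ℝ, (∀ n, 0 < ε n) ∧ Tendsto ε atTop (𝓝 0) ∧
      ∀ h : ℕ → ℝ, (∀ᶠ n in atTop, ε n ≤ h n * C n) → ArmBallsGrow x d h) := by
  obtain ⟨c, hc, hcC⟩ := hC
  obtain ⟨a, b, ha, hab⟩ := hσt
  have hC0 : ∀ n, 0 < C n := fun n => hc.trans_le (hcC n)
  have hk : NegligibleWeights fun n => optimalWeight σtsq (x n) (d n) (fs n) := fun w hw =>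
    eventually_optimalWeight_sq_le hδ hC0 harms hdens ha hab hfs hw
  have hcon : ∀ᶠ n in atTop, IsContrast (d n) (optimalWeight σtsq (x n) (d n) (fs n)) := by
    filter_upwards [harms] with n hn
    exact (hfs n hn.1 hn.2).isContrast hδ (fun z t => ha.trans_le (hab z t).1) hn.1
  refine ⟨fun J N nn hJ hN hnn hdup => ?_, fun h hh hball => ?_, exists_slow_bandwidth hC0 hdens⟩
  · exact hasAsymptoticCoverage_feasibleFLCI hα0 hα1 hK (fun n => (hC0 n).le) hP hk hcon
      (weightedVarianceConsistent_nn hK hc hcC hdens hσ hP hk hJ hN hnn hdup)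
  · exact hasAsymptoticCoverage_feasibleFLCI hα0 hα1 hK (fun n => (hC0 n).le) hP hk hcon
      (weightedVarianceConsistent_nw hK hC0 hP hk hh hball)
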